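/- **Setting.** Let $\mathbb K\in\{\mathbb R,\mathbb C\}$ and let $\mathbb H=H^1(0,1)\times L^2(0,1)$ (functions with values in $\mathbb K$) carry the inner product $$\langle(\phi_1,\psi_1),(\phi_2,\psi_2)\rangle_{\mathbb H}=\int_0^1\big[\phi_1'\overline{\phi_2'}+\psi_1\overline{\psi_2}\big]\,dx+\phi_1(0)\overline{\phi_2(0)} .$$ Let $\mathbb A(\phi,\psi)=(\psi,\phi'')$ with domain $$\mathcal D(\mathbb A)=\{(\phi,\psi)\in H^2(0,1)\times H^1(0,1)\;:\;\phi'(0)=\phi(0),\ \phi'(1)=0\}.$$ Then $\mathbb A^*=-\mathbb A$. Let $\mathbb H_{-1}$ be the dual of $\mathcal D(\mathbb A^*)$ (with the graph norm) with respect to the pivot space $\mathbb H$. Let $\mathbb B_1=(0,-\delta_0)$ and $\mathbb B_2=(0,\delta_1)$ be the bounded operators $\mathbb K\to\mathbb H_{-1}$ with adjoints $\mathbb B_1^*(\phi,\psi)=-\psi(0)$ and $\mathbb B_2^*(\phi,\psi)=\psi(1)$ for $(\phi,\psi)\in\mathcal D(\mathbb A^*)$. **Proposition 1.1.** (a) $\mathbb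 A$ generates a strongly continuous unitary group $(e^{\mathbb At})_{t\in\mathbb R}$ on $\mathbb H$, and $\mathbb B_1,\mathbb B_2$ are admissible control operators for it: for $i=1,2$, every $\tau>0$ and every $v\in L^2(0,\tau)$, the integral $\int_0^\tau e^{\mathbb A(\tau-\sigma)}\mathbb B_iv(\sigma)\,d\sigma$, which is taken in $\mathbb H_{-1}$, lies in $\mathbb H$, and it defines a bounded linear operator $L^2(0,\tau)\to\mathbb H$. (b) Let $q>0$ and let $f:\mathbb H\to\mathbb R$ be globally Lipschitz with $f(0,0)=0$. Then for all $(w_0,w_1)\in\mathbb H$ and all $u,d\in L^2_{\rm loc}[0,\infty)$ (with values in $\mathbb K$), the system $$\begin{cases} w_{tt}(x,t)=w_{xx}(x,t), & 0<x<1,\ t\ge 0,\\ w_x(0,t)=-q\,w(0,t),\\ w_x(1,t)=u(t)+f(w(\cdot,t),w_t(\cdot,t))+d(t),\\ w(x,0)=w_0(x),\quad w_t(x,0)=w_1(x),\end{cases}$$ has exactly one global solution $W=(w,w_t)\in C([0,\infty);\mathbb H)$. Here a solution is understood in either of the following two senses; the same $W$ is the unique solution in each of them. * *Abstract form:* $W(0)=(w_0,w_1)$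 and for all $t\ge0$, as an identity in $\mathbb H_{-1}$, $$W(t)-W(0)=\int_0^t\Big(\mathbb A W(s)-\mathbb B_1\big((q+1)\,w(0,s)\big)+\mathbb B_2\big[f(W(s))+u(s)+d(s)\big]\Big)ds .$$ * *Weak form:* $W=(w,v)$ satisfies $W(0)=(w_0,w_1)$, $\frac{d}{dt}w(\cdot,t)=v(\cdot,t)$ in $L^2(0,1)$ for all $t\ge0$, and for all $\eta\in H^1(0,1)$ and $t\ge0$, $$\int_0^1 \big(v(x,t)-w_1(x)\big)\overline{\eta(x)}\,dx=\int_0^t\Big(-\int_0^1 w_x(x,s)\overline{\eta'(x)}\,dx+q\,w(0,s)\overline{\eta(0)}+\big[u(s)+f(W(s))+d(s)\big]\overline{\eta(1)}\Big)ds .$$ -/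

import Mathlib

open MeasureTheory Set Filter
open scoped NNReal ENNReal Topology InnerProductSpace ComplexConjugate LinearPMap

namespace WaveSystem

/-! ### The spaces `L²(0,1)` and `H¹(0,1)` -/

/-- Lebesgue measure on the open interval `(0,1)`. -/
noncomputable abbrev μ01 : Measure ℝ := volume.restrict (Ioo (0 : ℝ) 1)

/-- The Hilbert space `L²(0,1)` of (classes of) `𝕜`-valued functions. -/
abbrev L2 (𝕜 : Type*) [RCLike 𝕜] : Type _ := Lp 𝕜 2 μ01

theorem L2.integrable {𝕜 : Type*} [RCLike 𝕜] (g : L2 𝕜) : Integrable g μ01 :=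
  (Lp.memLp g).integrable (by norm_num)

theorem L2.intervalIntegrable {𝕜 : Type*} [RCLike 𝕜] (g : L2 𝕜) :
    IntervalIntegrable g volume 0 1 := by
  rw [intervalIntegrable_iff_integrableOn_Ioo_of_le zero_le_one]
  exact L2.integrable g

theorem L2.intervalIntegrable' {𝕜 : Type*} [RCLike 𝕜] (g : L2 𝕜) (x : unitInterval) :
    IntervalIntegrable g volume 0 x :=
  (L2.intervalIntegrable g).mono_set (by
    rw [uIcc_of_le x.2.1, uIcc_of_le zero_le_one]
    exact Icc_subset_Icc le_rfl x.2.2)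

theorem L2.ae_eq {𝕜 : Type*} [RCLike 𝕜] {g h : ℝ → 𝕜} (hgh : g =ᵐ[μ01] h) (x : unitInterval) :
    ∫ s in (0 : ℝ)..x, g s = ∫ s in (0 : ℝ)..x, h s := by
  rw [intervalIntegral.integral_of_le x.2.1, intervalIntegral.integral_of_le x.2.1,
    integral_Ioc_eq_integral_Ioo, integral_Ioc_eq_integral_Ioo]
  refine integral_congr_ae (ae_restrict_of_ae_restrict_of_subset ?_ hgh)
  exact Ioo_subset_Ioo le_rfl x.2.2

theorem primitive_eq_Iio {𝕜 : Type*} [RCLike 𝕜] (g : ℝ → 𝕜) {x : ℝ} (hx : x ∈ Ioo (0 : ℝ) 1) :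
    ∫ s in (0 : ℝ)..x, g s = ∫ s, (Iio x).indicator g s ∂μ01 := by
  rw [intervalIntegral.integral_of_le hx.1.le, integral_Ioc_eq_integral_Ioo,
    integral_indicator measurableSet_Iio, Measure.restrict_restrict measurableSet_Iio]
  congr 2
  ext y
  simp only [mem_Ioo, mem_inter_iff, mem_Iio]
  constructor
  · rintro ⟨h1, h2⟩
    exact ⟨h2, h1, h2.trans hx.2⟩
  · rintro ⟨h1, h2, _⟩
    exact ⟨h2, h1⟩

theorem primitive_eq_Iic {𝕜 : Type*} [RCLike 𝕜] (g : ℝ → 𝕜) {x : ℝ} (hx : x ∈ Ioo (0 : ℝ) 1) :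
    ∫ s in (0 : ℝ)..x, g s = ∫ s, (Iic x).indicator g s ∂μ01 := by
  rw [intervalIntegral.integral_of_le hx.1.le,
    integral_indicator measurableSet_Iic, Measure.restrict_restrict measurableSet_Iic]
  congr 2
  ext y
  simp only [mem_Ioo, mem_inter_iff, mem_Iic, mem_Ioc]
  constructor
  · rintro ⟨h1, h2⟩
    exact ⟨h2, h1, h2.trans_lt hx.2⟩
  · rintro ⟨h1, h2, _⟩
    exact ⟨h2, h1⟩

theorem parts_aux {𝕜 : Type*} [RCLike 𝕜] {p g : ℝ → 𝕜} (hp : Integrable p μ01)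
    (hg : Integrable g μ01) :
    ∫ x, (∫ s in (0 : ℝ)..x, g s) * p x ∂μ01 + ∫ x, g x * (∫ s in (0 : ℝ)..x, p s) ∂μ01 =
      (∫ x, g x ∂μ01) * ∫ x, p x ∂μ01 := by
  have hK : Integrable (fun z : ℝ × ℝ => g z.1 * p z.2) (μ01.prod μ01) := hg.mul_prod hp
  have hS : MeasurableSet {z : ℝ × ℝ | z.1 < z.2} := measurableSet_lt measurable_fst measurable_snd
  have e1 : ∫ x, (∫ s in (0 : ℝ)..x, g s) * p x ∂μ01 =
      ∫ z, {z : ℝ × ℝ | z.1 < z.2}.indicator (fun z : ℝ × ℝ => g z.1 * p z.2) z ∂(μ01.prod μ01) := by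
    rw [integral_prod_symm _ (hK.indicator hS)]
    refine integral_congr_ae ((ae_restrict_iff' measurableSet_Ioo).2 (Eventually.of_forall ?_))
    intro x hx
    simp only
    rw [primitive_eq_Iio g hx, ← integral_mul_const]
    refine integral_congr_ae (Eventually.of_forall fun s => ?_)
    simp only [indicator, mem_Iio, mem_ofPred_eq]
    split_ifs <;> simp
  have e2 : ∫ x, g x * (∫ s in (0 : ℝ)..x, p s) ∂μ01 =
      ∫ z, {z : ℝ × ℝ | z.1 < z.2}ᶜ.indicator (fun z : ℝ × ℝ => g z.1 * p z.2) z
        ∂(μ01.prod μ01) := by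
    rw [integral_prod _ (hK.indicator hS.compl)]
    refine integral_congr_ae ((ae_restrict_iff' measurableSet_Ioo).2 (Eventually.of_forall ?_))
    intro x hx
    simp only
    rw [primitive_eq_Iic p hx, ← integral_const_mul]
    refine integral_congr_ae (Eventually.of_forall fun s => ?_)
    simp only [indicator, mem_Iic, mem_compl_iff, mem_ofPred_eq, not_lt]
    split_ifs <;> simp
  rw [e1, e2, integral_indicator hS, integral_indicator hS.compl, integral_add_compl hS hK,
    integral_prod_mul]

theorem L2.integral_norm_le {𝕜 : Type*} [RCLike 𝕜] (g : L2 𝕜) : ∫ x, ‖g x‖ ∂μ01 ≤ ‖g‖ := by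
  have : IsProbabilityMeasure μ01 := ⟨by simp⟩
  rw [integral_norm_eq_lintegral_enorm (Lp.aestronglyMeasurable g), ← eLpNorm_one_eq_lintegral_enorm,
    Lp.norm_def]
  exact ENNReal.toReal_mono (Lp.eLpNorm_ne_top g)
    (eLpNorm_le_eLpNorm_of_exponent_le (by norm_num) (Lp.aestronglyMeasurable g))

/-- `g` is the derivative of `φ`: one has `φ(x) = φ(0) + ∫₀ˣ g` for all `x ∈ [0,1]`. -/
def HasL2Deriv {𝕜 : Type*} [RCLike 𝕜] (φ : C(unitInterval, 𝕜)) (g : L2 𝕜) : Prop :=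
  ∀ x : unitInterval, φ x = φ 0 + ∫ s in (0 : ℝ)..x, g s

section H1

variable {𝕜 : Type*} [RCLike 𝕜]

theorem HasL2Deriv.add {φ ψ : C(unitInterval, 𝕜)} {g h : L2 𝕜}
    (hφ : HasL2Deriv φ g) (hψ : HasL2Deriv ψ h) : HasL2Deriv (φ + ψ) (g + h) := by
  intro x
  rw [L2.ae_eq (Lp.coeFn_add g h) x]
  simp only [Pi.add_apply]
  rw [intervalIntegral.integral_add (L2.intervalIntegrable' g x) (L2.intervalIntegrable' h x)]
  simp only [ContinuousMap.add_apply]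
  rw [hφ x, hψ x]
  ring

theorem HasL2Deriv.smul (c : 𝕜) {φ : C(unitInterval, 𝕜)} {g : L2 𝕜}
    (hφ : HasL2Deriv φ g) : HasL2Deriv (c • φ) (c • g) := by
  intro x
  rw [L2.ae_eq (Lp.coeFn_smul c g) x]
  simp only [Pi.smul_apply]
  rw [intervalIntegral.integral_smul]
  simp only [ContinuousMap.smul_apply]
  rw [hφ x, smul_add]

theorem HasL2Deriv.zero : HasL2Deriv (0 : C(unitInterval, 𝕜)) 0 := by
  simpa using (HasL2Deriv.smul (0 : 𝕜) (φ := 0) (g := 0) (by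
    intro x
    rw [L2.ae_eq (Lp.coeFn_zero 𝕜 2 μ01) x]
    simp))

/-- The derivative is unique as an element of `L²(0,1)`. -/
theorem HasL2Deriv.eq_zero {g : L2 𝕜} (h : HasL2Deriv (0 : C(unitInterval, 𝕜)) g) : g = 0 := by
  have h0 : ∀ x ∈ Icc (0 : ℝ) 1, ∫ s in (0 : ℝ)..x, g s = 0 := fun x hx => by
    simpa using (h ⟨x, hx⟩).symm
  have key := (L2.intervalIntegrable g).ae_hasDerivAt_integral
  rw [Lp.eq_zero_iff_ae_eq_zero]
  rw [uIcc_of_le zero_le_one] at key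
  refine (ae_restrict_iff' measurableSet_Ioo).2 ?_
  filter_upwards [key] with x hx hx1
  have h1 := hx (Ioo_subset_Icc_self hx1) 0 (by simp)
  have h2 : HasDerivAt (fun x => ∫ s in (0 : ℝ)..x, g s) 0 x :=
    (hasDerivAt_const x (0 : 𝕜)).congr_of_eventuallyEq (by
      filter_upwards [Icc_mem_nhds hx1.1 hx1.2] with y hy using h0 y hy)
  exact h1.unique h2

theorem HasL2Deriv.unique {φ : C(unitInterval, 𝕜)} {g h : L2 𝕜}
    (hg : HasL2Deriv φ g) (hh : HasL2Deriv φ h) : g = h := by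
  have h1 := hg.add (hh.smul (-1 : 𝕜))
  have e : φ + (-1 : 𝕜) • φ = 0 := by ext x; simp
  rw [e, neg_one_smul] at h1
  have := HasL2Deriv.eq_zero h1
  rwa [add_neg_eq_zero] at this

variable (𝕜) in
/-- The linear space underlying `H¹(0,1)`: the functions on `[0,1]` that are absolutely
continuous with derivative in `L²(0,1)`. -/
def h1Submodule : Submodule 𝕜 C(unitInterval, 𝕜) where
  carrier := {φ | ∃ g : L2 𝕜, HasL2Deriv φ g}
  add_mem' := by
    rintro φ ψ ⟨g, hg⟩ ⟨h, hh⟩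
    exact ⟨g + h, hg.add hh⟩
  zero_mem' := ⟨0, HasL2Deriv.zero⟩
  smul_mem' := by
    rintro c φ ⟨g, hg⟩
    exact ⟨c • g, hg.smul c⟩

variable (𝕜) in
/-- The Sobolev space `H¹(0,1)`, each class being given by its continuous representative
on `[0,1]`. -/
def H1 : Type _ := ↥(h1Submodule 𝕜)

namespace H1

instance : AddCommGroup (H1 𝕜) := inferInstanceAs (AddCommGroup ↥(h1Submodule 𝕜))

instance : Module 𝕜 (H1 𝕜) := inferInstanceAs (Module 𝕜 ↥(h1Submodule 𝕜))

/-- The continuous function on `[0,1]` underlying an element of `H¹(0,1)`. -/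
def toContinuousMap : H1 𝕜 →ₗ[𝕜] C(unitInterval, 𝕜) := (h1Submodule 𝕜).subtype

instance : CoeFun (H1 𝕜) (fun _ => unitInterval → 𝕜) := ⟨fun φ => toContinuousMap φ⟩

theorem toContinuousMap_injective :
    Function.Injective (toContinuousMap : H1 𝕜 →ₗ[𝕜] C(unitInterval, 𝕜)) :=
  Subtype.val_injective

@[simp] theorem add_apply (φ ψ : H1 𝕜) (x : unitInterval) : (φ + ψ) x = φ x + ψ x := rfl
@[simp] theorem smul_apply (c : 𝕜) (φ : H1 𝕜) (x : unitInterval) : (c • φ) x = c * φ x := rfl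
@[simp] theorem zero_apply (x : unitInterval) : (0 : H1 𝕜) x = 0 := rfl
@[simp] theorem neg_apply (φ : H1 𝕜) (x : unitInterval) : (-φ) x = -φ x := rfl

/-- The derivative `φ' ∈ L²(0,1)` of `φ ∈ H¹(0,1)`. -/
noncomputable def deriv : H1 𝕜 →ₗ[𝕜] L2 𝕜 where
  toFun φ := Classical.choose φ.2
  map_add' φ ψ := (Classical.choose_spec (φ + ψ).2).unique
    ((Classical.choose_spec φ.2).add (Classical.choose_spec ψ.2))
  map_smul' c φ := (Classical.choose_spec (c • φ).2).unique ((Classical.choose_spec φ.2).smul c)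

theorem hasL2Deriv (φ : H1 𝕜) : HasL2Deriv (toContinuousMap φ) (deriv φ) :=
  Classical.choose_spec φ.2

theorem apply_eq (φ : H1 𝕜) (x : unitInterval) :
    φ x = φ 0 + ∫ s in (0 : ℝ)..x, deriv φ s := hasL2Deriv φ x

/-- Every pair `(c, g) ∈ 𝕜 × L²(0,1)` is `(φ(0), φ')` for some `φ ∈ H¹(0,1)`. -/
theorem exists_primitive (c : 𝕜) (g : L2 𝕜) : ∃ φ : H1 𝕜, φ 0 = c ∧ deriv φ = g := by
  have hc : ContinuousOn (fun x : ℝ => ∫ s in (0 : ℝ)..x, g s) (Icc 0 1) := by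
    have := intervalIntegral.continuousOn_primitive_interval' (L2.intervalIntegrable g)
      (a := 0) (by simp)
    rwa [uIcc_of_le zero_le_one] at this
  let F : C(unitInterval, 𝕜) := ⟨fun x => c + ∫ s in (0 : ℝ)..x, g s,
    continuous_const.add (continuousOn_iff_continuous_domRestrict.1 hc)⟩
  have hF0 : F 0 = c := by simp [F]
  have hF : HasL2Deriv F g := fun x => by rw [hF0]; rfl
  exact ⟨⟨F, g, hF⟩, hF0, (hasL2Deriv (⟨F, g, hF⟩ : H1 𝕜)).unique hF⟩

/-- The pair `(φ(0), φ')` determines `φ`. -/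
theorem ext_deriv {φ ψ : H1 𝕜} (h0 : φ 0 = ψ 0) (h : deriv φ = deriv ψ) : φ = ψ := by
  apply toContinuousMap_injective
  ext x
  rw [apply_eq φ x, apply_eq ψ x, h0, h]

variable (𝕜) in
/-- The linear bijection `φ ↦ (φ(0), φ')`. -/
noncomputable def equivL2 : H1 𝕜 ≃ₗ[𝕜] WithLp 2 (𝕜 × L2 𝕜) :=
  LinearEquiv.ofBijective
    { toFun := fun φ => WithLp.toLp 2 (φ 0, deriv φ)
      map_add' := fun φ ψ => by
        rw [map_add deriv]
        rfl
      map_smul' := fun c φ => by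
        rw [map_smul deriv]
        rfl }
    ⟨fun φ ψ h => by
      have h' := (WithLp.toLp_injective 2 h)
      exact ext_deriv (congrArg Prod.fst h') (congrArg Prod.snd h'),
     fun p => by
      obtain ⟨φ, h1, h2⟩ := exists_primitive p.fst p.snd
      exact ⟨φ, by change WithLp.toLp 2 (φ 0, deriv φ) = p; rw [h1, h2]; rfl⟩⟩

/-- The norm `‖φ‖² = ∫₀¹ |φ'|² + |φ(0)|²` on `H¹(0,1)`. -/
noncomputable instance : NormedAddCommGroup (H1 𝕜) :=
  NormedAddCommGroup.induced (H1 𝕜) (WithLp 2 (𝕜 × L2 𝕜)) (equivL2 𝕜) (equivL2 𝕜).injective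

/-- The inner product on `H¹(0,1)`. As usual in Mathlib it is conjugate-linear in the first
argument. -/
noncomputable instance : Inner 𝕜 (H1 𝕜) where
  inner φ₁ φ₂ := (∫ x in Ioo (0 : ℝ) 1, deriv φ₂ x * conj (deriv φ₁ x)) + φ₂ 0 * conj (φ₁ 0)

theorem inner_eq (φ₁ φ₂ : H1 𝕜) : ⟪φ₁, φ₂⟫_𝕜 = ⟪equivL2 𝕜 φ₁, equivL2 𝕜 φ₂⟫_𝕜 := by
  rw [WithLp.prod_inner_apply, add_comm]
  rfl

noncomputable instance : InnerProductSpace 𝕜 (H1 𝕜) where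
  norm_smul_le c φ := by
    change ‖equivL2 𝕜 (c • φ)‖ ≤ ‖c‖ * ‖equivL2 𝕜 φ‖
    rw [map_smul, norm_smul]
  norm_sq_eq_re_inner φ := by
    rw [inner_eq]
    exact norm_sq_eq_re_inner (𝕜 := 𝕜) (equivL2 𝕜 φ)
  conj_inner_symm φ₁ φ₂ := by
    rw [inner_eq, inner_eq, inner_conj_symm]
  add_left φ₁ φ₂ φ₃ := by
    rw [inner_eq, inner_eq, inner_eq, map_add, inner_add_left]
  smul_left φ₁ φ₂ c := by
    rw [inner_eq, inner_eq, map_smul, inner_smul_left]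

theorem inner_def (φ₁ φ₂ : H1 𝕜) :
    ⟪φ₁, φ₂⟫_𝕜 =
      (∫ x in Ioo (0 : ℝ) 1, deriv φ₂ x * conj (deriv φ₁ x)) + φ₂ 0 * conj (φ₁ 0) := rfl

theorem inner_eq_add (φ₁ φ₂ : H1 𝕜) :
    ⟪φ₁, φ₂⟫_𝕜 = ⟪deriv φ₁, deriv φ₂⟫_𝕜 + ⟪φ₁ 0, φ₂ 0⟫_𝕜 := rfl

variable (𝕜) in
/-- The isometry `φ ↦ (φ(0), φ')` of `H¹(0,1)` onto `𝕜 × L²(0,1)`. -/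
noncomputable def isometryL2 : H1 𝕜 ≃ₗᵢ[𝕜] WithLp 2 (𝕜 × L2 𝕜) where
  toLinearEquiv := equivL2 𝕜
  norm_map' _ := rfl

instance : CompleteSpace (H1 𝕜) :=
  (isometryL2 𝕜).toIsometryEquiv.completeSpace

theorem norm_sq_eq (φ : H1 𝕜) : ‖φ‖ ^ 2 = ‖φ 0‖ ^ 2 + ‖deriv φ‖ ^ 2 :=
  WithLp.prod_norm_sq_eq_of_L2 (equivL2 𝕜 φ)

theorem norm_apply_le (φ : H1 𝕜) (x : unitInterval) : ‖φ x‖ ≤ 2 * ‖φ‖ := by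
  have h0 : ‖φ 0‖ ≤ ‖φ‖ := by
    refine (sq_le_sq₀ (norm_nonneg _) (norm_nonneg _)).1 ?_
    rw [norm_sq_eq]
    nlinarith [sq_nonneg ‖deriv φ‖]
  have h1 : ‖deriv φ‖ ≤ ‖φ‖ := by
    refine (sq_le_sq₀ (norm_nonneg _) (norm_nonneg _)).1 ?_
    rw [norm_sq_eq]
    nlinarith [sq_nonneg ‖φ 0‖]
  have h2 : ‖∫ s in (0 : ℝ)..x, deriv φ s‖ ≤ ‖deriv φ‖ := by
    refine (intervalIntegral.norm_integral_le_integral_norm x.2.1).trans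
      (le_trans ?_ (L2.integral_norm_le (deriv φ)))
    rw [intervalIntegral.integral_of_le x.2.1, integral_Ioc_eq_integral_Ioo]
    exact setIntegral_mono_set (L2.integrable (deriv φ)).norm
      (Eventually.of_forall fun _ => norm_nonneg _)
      (Ioo_subset_Ioo le_rfl x.2.2).eventuallyLE
  rw [apply_eq φ x]
  linarith [norm_add_le (φ 0) (∫ s in (0 : ℝ)..x, deriv φ s)]

/-- Point evaluation `φ ↦ φ(x)` on `H¹(0,1)`. -/
noncomputable def evalCLM (x : unitInterval) : H1 𝕜 →L[𝕜] 𝕜 :=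
  LinearMap.mkContinuous
    { toFun := fun φ => φ x
      map_add' := fun φ ψ => add_apply φ ψ x
      map_smul' := fun c φ => smul_apply c φ x } 2 (fun φ => norm_apply_le φ x)

/-- The extension of `φ` to the real line that is constant outside `[0,1]`. -/
noncomputable def extend (φ : H1 𝕜) : ℝ → 𝕜 := IccExtend zero_le_one (fun x => φ x)

theorem continuous_extend (φ : H1 𝕜) : Continuous (extend φ) :=
  (toContinuousMap φ).continuous.Icc_extend'

theorem extend_of_mem (φ : H1 𝕜) {x : ℝ} (hx : x ∈ Icc (0 : ℝ) 1) : extend φ x = φ ⟨x, hx⟩ :=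
  IccExtend_of_mem _ _ hx

theorem memLp_extend (φ : H1 𝕜) : MemLp (extend φ) 2 μ01 :=
  MemLp.of_bound (continuous_extend φ).aestronglyMeasurable (2 * ‖φ‖)
    (Eventually.of_forall fun _ => norm_apply_le φ _)

/-- The embedding `H¹(0,1) ⊂ L²(0,1)`. -/
noncomputable def toL2 : H1 𝕜 →ₗ[𝕜] L2 𝕜 where
  toFun φ := (memLp_extend φ).toLp (extend φ)
  map_add' φ ψ := MemLp.toLp_add (memLp_extend φ) (memLp_extend ψ)
  map_smul' c φ := MemLp.toLp_const_smul c (memLp_extend φ)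

theorem toL2_ae (φ : H1 𝕜) : toL2 φ =ᵐ[μ01] extend φ := MemLp.coeFn_toLp (memLp_extend φ)

theorem toL2_injective : Function.Injective (toL2 : H1 𝕜 →ₗ[𝕜] L2 𝕜) := by
  intro φ ψ h
  apply toContinuousMap_injective
  have h1 : extend φ =ᵐ[volume.restrict (Icc (0 : ℝ) 1)] extend ψ := by
    rw [← restrict_Ioo_eq_restrict_Icc]
    exact (toL2_ae φ).symm.trans ((by rw [h] : toL2 φ =ᵐ[μ01] toL2 ψ).trans (toL2_ae ψ))
  have h2 := Measure.eqOn_Icc_of_ae_eq volume zero_ne_one h1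
    (continuous_extend φ).continuousOn (continuous_extend ψ).continuousOn
  ext x
  have := h2 x.2
  rwa [extend_of_mem φ x.2, extend_of_mem ψ x.2] at this

/-- Integration by parts. -/
theorem integral_by_parts (φ ψ : H1 𝕜) :
    ⟪deriv φ, toL2 ψ⟫_𝕜 + ⟪toL2 φ, deriv ψ⟫_𝕜 = ψ 1 * conj (φ 1) - ψ 0 * conj (φ 0) := by
  have hf := L2.integrable (deriv φ)
  have hg := L2.integrable (deriv ψ)
  have hcf : Integrable (fun x => conj (deriv φ x)) μ01 :=
    (RCLike.conjCLE (K := 𝕜)).toContinuousLinearMap.integrable_comp hf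
  have hφ : ∀ x ∈ Ioo (0 : ℝ) 1, extend φ x = φ 0 + ∫ s in (0 : ℝ)..x, deriv φ s := fun x hx => by
    rw [extend_of_mem φ (Ioo_subset_Icc_self hx)]
    exact apply_eq φ _
  have hψ : ∀ x ∈ Ioo (0 : ℝ) 1, extend ψ x = ψ 0 + ∫ s in (0 : ℝ)..x, deriv ψ s := fun x hx => by
    rw [extend_of_mem ψ (Ioo_subset_Icc_self hx)]
    exact apply_eq ψ _
  have hconj : ∀ x : ℝ, conj (∫ s in (0 : ℝ)..x, deriv φ s) =
      ∫ s in (0 : ℝ)..x, conj (deriv φ s) := fun x => by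
    rw [intervalIntegral.intervalIntegral_eq_integral_uIoc,
      intervalIntegral.intervalIntegral_eq_integral_uIoc, RCLike.real_smul_eq_coe_mul,
      RCLike.real_smul_eq_coe_mul, map_mul, RCLike.conj_ofReal, integral_conj]
  have one : ∀ g : ℝ → 𝕜, ∫ s in (0 : ℝ)..1, g s = ∫ s, g s ∂μ01 := fun g => by
    rw [intervalIntegral.integral_of_le zero_le_one, integral_Ioc_eq_integral_Ioo]
  have i1 : ⟪deriv φ, toL2 ψ⟫_𝕜 =
      ψ 0 * (∫ x, conj (deriv φ x) ∂μ01) +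
        ∫ x, (∫ s in (0 : ℝ)..x, deriv ψ s) * conj (deriv φ x) ∂μ01 := by
    have hint := MeasureTheory.L2.integrable_inner (𝕜 := 𝕜) (deriv φ) (toL2 ψ)
    have e : (fun x => ⟪deriv φ x, toL2 ψ x⟫_𝕜 - ψ 0 * conj (deriv φ x)) =ᵐ[μ01]
        fun x => (∫ s in (0 : ℝ)..x, deriv ψ s) * conj (deriv φ x) := by
      filter_upwards [toL2_ae ψ, ae_restrict_mem measurableSet_Ioo] with x hx hx1
      rw [RCLike.inner_apply, hx, hψ x hx1]
      ring
    rw [← integral_congr_ae e, integral_sub hint (hcf.const_mul _), integral_const_mul,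
      MeasureTheory.L2.inner_def]
    ring
  have i2 : ⟪toL2 φ, deriv ψ⟫_𝕜 =
      conj (φ 0) * (∫ x, deriv ψ x ∂μ01) +
        ∫ x, deriv ψ x * (∫ s in (0 : ℝ)..x, conj (deriv φ s)) ∂μ01 := by
    have hint := MeasureTheory.L2.integrable_inner (𝕜 := 𝕜) (toL2 φ) (deriv ψ)
    have e : (fun x => ⟪toL2 φ x, deriv ψ x⟫_𝕜 - conj (φ 0) * deriv ψ x) =ᵐ[μ01]
        fun x => deriv ψ x * (∫ s in (0 : ℝ)..x, conj (deriv φ s)) := by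
      filter_upwards [toL2_ae φ, ae_restrict_mem measurableSet_Ioo] with x hx hx1
      rw [RCLike.inner_apply, hx, hφ x hx1, map_add, hconj]
      ring
    rw [← integral_congr_ae e, integral_sub hint (hg.const_mul _), integral_const_mul,
      MeasureTheory.L2.inner_def]
    ring
  have hφ1 : φ 1 = φ 0 + ∫ x, deriv φ x ∂μ01 := by
    rw [← one]; exact apply_eq φ 1
  have hψ1 : ψ 1 = ψ 0 + ∫ x, deriv ψ x ∂μ01 := by
    rw [← one]; exact apply_eq ψ 1
  have key := parts_aux hcf hg
  rw [i1, i2, hφ1, hψ1, map_add, ← integral_conj]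
  linear_combination key

end H1

end H1

/-! ### Unitary groups, the extrapolation space and admissibility -/

section Abstract

variable {𝕜 : Type*} [RCLike 𝕜]
variable {X : Type*} [NormedAddCommGroup X] [InnerProductSpace 𝕜 X]

variable (𝕜 X) in
/-- A strongly continuous group of unitary operators on the Hilbert space `X`. -/
structure UnitaryGroup where
  toFun : ℝ → X ≃ₗᵢ[𝕜] X
  map_zero' : ∀ x, toFun 0 x = x
  map_add' : ∀ s t x, toFun (s + t) x = toFun s (toFun t x)
  continuous' : ∀ x, Continuous fun t => toFun t x

instance : CoeFun (UnitaryGroup 𝕜 X) (fun _ => ℝ → X ≃ₗᵢ[𝕜] X) := ⟨UnitaryGroup.toFun⟩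

/-- `A` is the generator of `T`: `x ∈ D(A)` and `A x = y` if and only if
`(T(t) x - x) / t → y` as `t → 0`. -/
def IsGenerator (A : X →ₗ.[𝕜] X) (T : UnitaryGroup 𝕜 X) : Prop :=
  ∀ x y : X, (x, y) ∈ A.graph ↔
    Tendsto (fun t : ℝ => (t : 𝕜)⁻¹ • (T t x - x)) (𝓝[≠] 0) (𝓝 y)

theorem IsGenerator.map_graph {A : X →ₗ.[𝕜] X} {T : UnitaryGroup 𝕜 X} (hT : IsGenerator A T)
    (t : ℝ) {x y : X} (h : (x, y) ∈ A.graph) : (T t x, T t y) ∈ A.graph := by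
  rw [hT] at h ⊢
  have h1 := ((T t).continuous.tendsto y).comp h
  refine h1.congr fun s => ?_
  simp only [Function.comp_apply]
  rw [map_smul, map_sub, ← T.map_add', ← T.map_add', add_comm]

variable [CompleteSpace X]

/-- The domain `D(A*)` with its graph norm, as the graph of `A*`: a point is a pair `(z, A* z)`,
with norm `max ‖z‖ ‖A* z‖`. -/
def AdjointDomain (A : X →ₗ.[𝕜] X) : Type _ := ↥(A†.graph)

noncomputable instance (A : X →ₗ.[𝕜] X) : NormedAddCommGroup (AdjointDomain A) :=
  inferInstanceAs (NormedAddCommGroup ↥(A†.graph))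

noncomputable instance (A : X →ₗ.[𝕜] X) : NormedSpace 𝕜 (AdjointDomain A) :=
  inferInstanceAs (NormedSpace 𝕜 ↥(A†.graph))

/-- The inclusion `D(A*) → X`. -/
noncomputable def AdjointDomain.incl (A : X →ₗ.[𝕜] X) : AdjointDomain A →L[𝕜] X :=
  LinearMap.mkContinuous
    { toFun := fun z => z.1.1
      map_add' := fun _ _ => rfl
      map_smul' := fun _ _ => rfl } 1 (fun z => by
        rw [one_mul]
        exact norm_fst_le z.1)

/-- The operator `A*` as a bounded operator `D(A*) → X`. -/
noncomputable def AdjointDomain.adj (A : X →ₗ.[𝕜] X) : AdjointDomain A →L[𝕜] X :=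
  LinearMap.mkContinuous
    { toFun := fun z => z.1.2
      map_add' := fun _ _ => rfl
      map_smul' := fun _ _ => rfl } 1 (fun z => by
        rw [one_mul]
        exact norm_snd_le z.1)

/-- The space `X₋₁`, the dual of `D(A*)` (with the graph norm) with respect to the pivot space
`X`. Its elements are the bounded conjugate-linear functionals on `D(A*)`. -/
abbrev Extrapolation (A : X →ₗ.[𝕜] X) : Type _ := AdjointDomain A →L⋆[𝕜] 𝕜

/-- The operator `B : U → X₋₁` with a given adjoint `C = B* : D(A*) → U`: here `B c` acts as
`z ↦ ⟪C z, c⟫`. -/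
noncomputable def dualOp {U : Type*} [NormedAddCommGroup U] [InnerProductSpace 𝕜 U]
    {A : X →ₗ.[𝕜] X} (C : AdjointDomain A →L[𝕜] U) : U →L[𝕜] Extrapolation A :=
  LinearMap.mkContinuous
    { toFun := fun c => ((innerSL 𝕜).flip c).comp C
      map_add' := fun c d => by
        ext z
        simp
      map_smul' := fun a c => by
        ext z
        simp } ‖C‖ (fun c => by
      refine ContinuousLinearMap.opNorm_le_bound _ (by positivity) fun z => ?_
      change ‖⟪C z, c⟫_𝕜‖ ≤ _
      calc ‖⟪C z, c⟫_𝕜‖ ≤ ‖C z‖ * ‖c‖ := norm_inner_le_norm _ _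
        _ ≤ ‖C‖ * ‖z‖ * ‖c‖ := by gcongr; exact C.le_opNorm z
        _ = ‖C‖ * ‖c‖ * ‖z‖ := by ring)

@[simp] theorem dualOp_apply {U : Type*} [NormedAddCommGroup U] [InnerProductSpace 𝕜 U]
    {A : X →ₗ.[𝕜] X} (C : AdjointDomain A →L[𝕜] U) (c : U) (z : AdjointDomain A) :
    dualOp C c z = ⟪C z, c⟫_𝕜 := rfl

/-- The embedding `X ⊂ X₋₁`, where `x` acts as `z ↦ ⟪z, x⟫`. -/
noncomputable def embed (A : X →ₗ.[𝕜] X) : X →L[𝕜] Extrapolation A :=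
  dualOp (AdjointDomain.incl A)

/-- The extension of `A` to an operator `X → X₋₁`, where `A x` acts as `z ↦ ⟪A* z, x⟫`. -/
noncomputable def extendOp (A : X →ₗ.[𝕜] X) : X →L[𝕜] Extrapolation A :=
  dualOp (AdjointDomain.adj A)

@[simp] theorem embed_apply (A : X →ₗ.[𝕜] X) (x : X) (z : AdjointDomain A) :
    embed A x z = ⟪z.1.1, x⟫_𝕜 := rfl

@[simp] theorem extendOp_apply (A : X →ₗ.[𝕜] X) (x : X) (z : AdjointDomain A) :
    extendOp A x z = ⟪z.1.2, x⟫_𝕜 := rfl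

/-- `T(t)*` leaves `D(A*)` invariant and commutes there with `A*`. -/
theorem IsGenerator.symm_map_graph {A : X →ₗ.[𝕜] X} {T : UnitaryGroup 𝕜 X}
    (hT : IsGenerator A T) (t : ℝ) (z : AdjointDomain A) :
    ((T t).symm z.1.1, (T t).symm z.1.2) ∈ A†.graph := by
  have hmap : ∀ x : A.domain, ∃ h : T t x ∈ A.domain, A ⟨T t x, h⟩ = T t (A x) := by
    intro x
    obtain ⟨y, h1, h2⟩ := (LinearPMap.mem_graph_iff A).1 (hT.map_graph t (A.mem_graph x))
    have h3 : T t x ∈ A.domain := by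
      have h5 : (y : X) = T t x := h1
      rw [← h5]
      exact y.2
    have h4 : (⟨T t x, h3⟩ : A.domain) = y := Subtype.ext h1.symm
    exact ⟨h3, by rw [h4]; exact h2⟩
  obtain ⟨y, h1, h2⟩ := (LinearPMap.mem_graph_iff A†).1 z.2
  have hy : Continuous ((innerₛₗ 𝕜 (y : X)).comp A.toFun) :=
    (LinearPMap.mem_adjoint_domain_iff A (y : X)).1 y.2
  have hmem : (T t).symm z.1.1 ∈ A†.domain := by
    rw [LinearPMap.mem_adjoint_domain_iff]
    let m : A.domain → A.domain := fun x => ⟨T t x, (hmap x).1⟩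
    have hm : Continuous m := by
      refine Continuous.subtype_mk ?_ _
      exact (T t).continuous.comp continuous_subtype_val
    convert hy.comp hm using 1
    funext x
    change ⟪(T t).symm z.1.1, A x⟫_𝕜 = ⟪(y : X), A (m x)⟫_𝕜
    rw [(hmap x).2, h1, ← LinearIsometryEquiv.inner_map_map (T t), LinearIsometryEquiv.apply_symm_apply]
  refine (LinearPMap.mem_graph_iff A†).2 ⟨⟨_, hmem⟩, rfl, ?_⟩
  by_cases hd : Dense (A.domain : Set X)
  · refine LinearPMap.adjoint_apply_eq hd _ fun x => ?_
    change ⟪(T t).symm z.1.2, (x : X)⟫_𝕜 = ⟪(T t).symm z.1.1, A x⟫_𝕜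
    rw [← LinearIsometryEquiv.inner_map_map (T t), LinearIsometryEquiv.apply_symm_apply,
      ← LinearIsometryEquiv.inner_map_map (T t) _ (A x), LinearIsometryEquiv.apply_symm_apply,
      ← (hmap x).2, ← h1, ← h2]
    exact LinearPMap.adjoint_isFormalAdjoint hd y ⟨T t x, (hmap x).1⟩
  · rw [LinearPMap.adjoint_apply_of_not_dense hd] at h2 ⊢
    rw [← h2, map_zero]

/-- The operator `T(t)*`, restricted to `D(A*)`. -/
noncomputable def IsGenerator.adjointOp {A : X →ₗ.[𝕜] X} {T : UnitaryGroup 𝕜 X}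
    (hT : IsGenerator A T) (t : ℝ) : AdjointDomain A →L[𝕜] AdjointDomain A :=
  LinearMap.mkContinuous
    { toFun := fun z => ⟨((T t).symm z.1.1, (T t).symm z.1.2), hT.symm_map_graph t z⟩
      map_add' := fun z w => Subtype.ext
        (Prod.ext (map_add (T t).symm z.1.1 w.1.1) (map_add (T t).symm z.1.2 w.1.2))
      map_smul' := fun c z => Subtype.ext
        (Prod.ext (map_smul (T t).symm c z.1.1) (map_smul (T t).symm c z.1.2)) } 1 (fun z => by
        rw [one_mul]
        change max ‖(T t).symm z.1.1‖ ‖(T t).symm z.1.2‖ ≤ max ‖z.1.1‖ ‖z.1.2‖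
        rw [LinearIsometryEquiv.norm_map, LinearIsometryEquiv.norm_map])

/-- The extension of the operator `T(t)` to `X₋₁`, where `T(t) ξ` acts as `z ↦ ξ (T(t)* z)`. -/
noncomputable def IsGenerator.extrapolate {A : X →ₗ.[𝕜] X} {T : UnitaryGroup 𝕜 X}
    (hT : IsGenerator A T) (t : ℝ) : Extrapolation A →L[𝕜] Extrapolation A :=
  LinearMap.mkContinuous
    { toFun := fun ξ => ξ.comp (hT.adjointOp t)
      map_add' := fun ξ ξ' => ContinuousLinearMap.add_comp ξ ξ' _
      map_smul' := fun a ξ => ContinuousLinearMap.smul_comp a ξ _ } ‖hT.adjointOp t‖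
    (fun ξ => (ξ.opNorm_comp_le _).trans_eq (mul_comm _ _))

theorem IsGenerator.extrapolate_apply {A : X →ₗ.[𝕜] X} {T : UnitaryGroup 𝕜 X}
    (hT : IsGenerator A T) (t : ℝ) (ξ : Extrapolation A) (z : AdjointDomain A) :
    hT.extrapolate t ξ z = ξ (hT.adjointOp t z) := rfl

theorem IsGenerator.extrapolate_embed {A : X →ₗ.[𝕜] X} {T : UnitaryGroup 𝕜 X}
    (hT : IsGenerator A T) (t : ℝ) (x : X) :
    hT.extrapolate t (embed A x) = embed A (T t x) := by
  ext z
  change ⟪(T t).symm z.1.1, x⟫_𝕜 = ⟪z.1.1, T t x⟫_𝕜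
  rw [← LinearIsometryEquiv.inner_map_map (T t), LinearIsometryEquiv.apply_symm_apply]

/-- `B` is an admissible control operator for the group `T` generated by `A`: for every `τ > 0`
the `X₋₁`-valued integral `∫₀^τ T(τ - σ) B v(σ) dσ` lies in `X` for all `v ∈ L²((0,τ); U)`, and
as an element of `X` it depends linearly and continuously on `v`. (It is well known that this
holds for every `τ` as soon as the integral lies in `X` for all `v` and one `τ`.) -/
def IsAdmissible {U : Type*} [NormedAddCommGroup U] [NormedSpace 𝕜 U] {A : X →ₗ.[𝕜] X}
    {T : UnitaryGroup 𝕜 X} (hT : IsGenerator A T) (B : U →L[𝕜] Extrapolation A) : Prop :=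
  ∀ τ : ℝ, 0 < τ → ∃ Φ : Lp U 2 (volume.restrict (Ioc (0 : ℝ) τ)) →L[𝕜] X,
    ∀ v : Lp U 2 (volume.restrict (Ioc (0 : ℝ) τ)),
      IntegrableOn (fun σ : ℝ => hT.extrapolate (τ - σ) (B (v σ))) (Ioc 0 τ) ∧
      embed A (Φ v) = ∫ σ in Ioc (0 : ℝ) τ, hT.extrapolate (τ - σ) (B (v σ))

end Abstract

/-! ### The wave operator -/

section Wave

variable (𝕜 : Type*) [RCLike 𝕜]

/-- The state space `ℍ = H¹(0,1) × L²(0,1)`. -/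
abbrev StateSpace : Type _ := WithLp 2 (H1 𝕜 × L2 𝕜)

theorem StateSpace.inner_def (z₁ z₂ : StateSpace 𝕜) :
    ⟪z₁, z₂⟫_𝕜 =
      (∫ x in Ioo (0 : ℝ) 1, H1.deriv z₂.fst x * conj (H1.deriv z₁.fst x)) +
        z₂.fst 0 * conj (z₁.fst 0) + ∫ x in Ioo (0 : ℝ) 1, z₂.snd x * conj (z₁.snd x) := rfl

/-- The graph of `𝔸`. A pair `((φ, ψ), (η, ζ))` belongs to it if `ψ = η ∈ H¹(0,1)`, if
`φ' = χ ∈ H¹(0,1)` (so that `φ ∈ H²(0,1)`), if `ζ = χ' = φ''`, and if `φ'(0) = φ(0)` and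
`φ'(1) = 0`. -/
def waveGraph : Submodule 𝕜 (StateSpace 𝕜 × StateSpace 𝕜) where
  carrier := {p | p.1.snd = H1.toL2 p.2.fst ∧ ∃ χ : H1 𝕜, H1.deriv p.1.fst = H1.toL2 χ ∧
    p.2.snd = H1.deriv χ ∧ χ 0 = p.1.fst 0 ∧ χ 1 = 0}
  add_mem' := by
    rintro p p' ⟨h1, χ, h2, h3, h4, h5⟩ ⟨h1', χ', h2', h3', h4', h5'⟩
    refine ⟨?_, χ + χ', ?_, ?_, ?_, ?_⟩
    · simp [h1, h1']
    · simp [h2, h2']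
    · simp [h3, h3']
    · simp [h4, h4']
    · simp [h5, h5']
  zero_mem' := ⟨by simp, 0, by simp, by simp, by simp, by simp⟩
  smul_mem' := by
    rintro c p ⟨h1, χ, h2, h3, h4, h5⟩
    refine ⟨?_, c • χ, ?_, ?_, ?_, ?_⟩
    · simp [h1]
    · simp [h2]
    · simp [h3]
    · simp [h4]
    · simp [h5]

/-- The operator `𝔸 (φ, ψ) = (ψ, φ'')` with domain
`{(φ, ψ) ∈ H²(0,1) × H¹(0,1) | φ'(0) = φ(0), φ'(1) = 0}`. -/
noncomputable def waveOp : StateSpace 𝕜 →ₗ.[𝕜] StateSpace 𝕜 := (waveGraph 𝕜).toLinearPMap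

variable {𝕜} in
theorem waveGraph_snd_eq_zero (p : StateSpace 𝕜 × StateSpace 𝕜) (hp : p ∈ waveGraph 𝕜)
    (h0 : p.1 = 0) : p.2 = 0 := by
  obtain ⟨h1, χ, h2, h3, -, -⟩ := hp
  have e1 : p.2.fst = 0 := by
    apply H1.toL2_injective
    rw [← h1, h0, map_zero]
    rfl
  have e2 : χ = 0 := by
    apply H1.toL2_injective
    rw [← h2, h0, map_zero]
    exact map_zero H1.deriv
  have e3 : p.2.snd = 0 := by rw [h3, e2, map_zero]
  exact WithLp.ofLp_injective 2 (Prod.ext e1 e3)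

theorem waveOp_graph : (waveOp 𝕜).graph = waveGraph 𝕜 :=
  Submodule.toLinearPMap_graph_eq _ waveGraph_snd_eq_zero

variable {𝕜} in
theorem waveGraph_skew {p r : StateSpace 𝕜 × StateSpace 𝕜} (hp : p ∈ waveGraph 𝕜)
    (hr : r ∈ waveGraph 𝕜) : ⟪p.2, r.1⟫_𝕜 = -⟪p.1, r.2⟫_𝕜 := by
  obtain ⟨h1, χ, h2, h3, h4, h5⟩ := hp
  obtain ⟨k1, ξ, k2, k3, k4, k5⟩ := hr
  have e1 := H1.integral_by_parts χ r.2.fst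
  have e2 := H1.integral_by_parts p.2.fst ξ
  rw [WithLp.prod_inner_apply, WithLp.prod_inner_apply]
  change ⟪p.2.fst, r.1.fst⟫_𝕜 + ⟪p.2.snd, r.1.snd⟫_𝕜 =
    -(⟪p.1.fst, r.2.fst⟫_𝕜 + ⟪p.1.snd, r.2.snd⟫_𝕜)
  rw [H1.inner_eq_add, H1.inner_eq_add, h1, h2, h3, k1, k2, k3, ← h4, ← k4,
    RCLike.inner_apply, RCLike.inner_apply]
  rw [h5, map_zero, mul_zero] at e1
  rw [k5, zero_mul] at e2
  linear_combination e1 + e2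

variable {𝕜} in
theorem waveGraph_surj (y : StateSpace 𝕜) : ∃ z, (z, y) ∈ waveGraph 𝕜 := by
  obtain ⟨χ, hχ0, hχ⟩ := H1.exists_primitive (-∫ s in (0 : ℝ)..(1 : unitInterval), y.snd s) y.snd
  obtain ⟨φ, hφ0, hφ⟩ := H1.exists_primitive (χ 0) (H1.toL2 χ)
  refine ⟨WithLp.toLp 2 (φ, H1.toL2 y.fst), rfl, χ, hφ, hχ.symm, hφ0.symm, ?_⟩
  rw [H1.apply_eq, hχ0, hχ, neg_add_cancel]

theorem waveOp_dense : Dense ((waveOp 𝕜).domain : Set (StateSpace 𝕜)) := by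
  rw [Submodule.dense_iff_topologicalClosure_eq_top, Submodule.topologicalClosure_eq_top_iff,
    Submodule.eq_bot_iff]
  intro z hz
  obtain ⟨w, hw⟩ := waveGraph_surj z
  obtain ⟨x, hx⟩ := waveGraph_surj w
  have hxd : x ∈ (waveOp 𝕜).domain :=
    LinearPMap.mem_domain_of_mem_graph (f := waveOp 𝕜) (y := w) (by rw [waveOp_graph]; exact hx)
  have h1 : ⟪w, w⟫_𝕜 = -⟪x, z⟫_𝕜 := waveGraph_skew hx hw
  rw [(Submodule.mem_orthogonal _ _).1 hz x hxd, neg_zero, inner_self_eq_zero] at h1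
  exact waveGraph_snd_eq_zero (w, z) hw h1

/-- `𝔸* = -𝔸`. -/
theorem mem_adjoint_graph_iff (p : StateSpace 𝕜 × StateSpace 𝕜) :
    p ∈ (waveOp 𝕜)†.graph ↔ (p.1, -p.2) ∈ waveGraph 𝕜 := by
  rw [LinearPMap.adjoint_graph_eq_graph_adjoint (waveOp_dense 𝕜), Submodule.mem_adjoint_iff,
    waveOp_graph]
  constructor
  · intro h
    obtain ⟨w, hw⟩ := waveGraph_surj (-p.2)
    have hwp : w = p.1 := by
      refine ext_inner_left 𝕜 fun b => ?_
      obtain ⟨a, ha⟩ := waveGraph_surj b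
      have h1 : ⟪b, w⟫_𝕜 = -⟪a, -p.2⟫_𝕜 := waveGraph_skew ha hw
      have h2 := h a b ha
      rw [sub_eq_zero] at h2
      rw [inner_neg_right, neg_neg, ← h2] at h1
      exact h1
    rwa [hwp] at hw
  · intro h a b hab
    have h1 : ⟪b, p.1⟫_𝕜 = -⟪a, -p.2⟫_𝕜 :=
      waveGraph_skew (p := (a, b)) (r := (p.1, -p.2)) hab h
    rw [h1, inner_neg_right, neg_neg, sub_self]

/-- The functional `(φ, ψ) ↦ ψ(x)` on `D(𝔸*)`. It is written through `𝔸*(φ, ψ) = (-ψ, -φ'')`,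
where `ψ` is taken as an element of `H¹(0,1)`. -/
noncomputable def velocityAt (x : unitInterval) : AdjointDomain (waveOp 𝕜) →L[𝕜] 𝕜 :=
  -((H1.evalCLM x).comp ((WithLp.fstL 2 𝕜 (H1 𝕜) (L2 𝕜)).comp (AdjointDomain.adj (waveOp 𝕜))))

theorem velocityAt_eq (x : unitInterval) (z : AdjointDomain (waveOp 𝕜)) (ψ : H1 𝕜)
    (hψ : (AdjointDomain.incl (waveOp 𝕜) z).snd = H1.toL2 ψ) : velocityAt 𝕜 x z = ψ x := by
  have h := ((mem_adjoint_graph_iff 𝕜 z.1).1 z.2).1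
  have h1 : H1.toL2 ψ = H1.toL2 (-z.1.2).fst := hψ.symm.trans h
  rw [H1.toL2_injective h1]
  rfl

/-- The control operator `𝔹₁ = (0, -δ₀)`, with adjoint `𝔹₁*(φ, ψ) = -ψ(0)`. -/
noncomputable def controlOp₁ : 𝕜 →L[𝕜] Extrapolation (waveOp 𝕜) := dualOp (-velocityAt 𝕜 0)

/-- The control operator `𝔹₂ = (0, δ₁)`, with adjoint `𝔹₂*(φ, ψ) = ψ(1)`. -/
noncomputable def controlOp₂ : 𝕜 →L[𝕜] Extrapolation (waveOp 𝕜) := dualOp (velocityAt 𝕜 1)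

end Wave

/-! ### The nonlinear plant -/

section Plant

variable {𝕜 : Type*} [RCLike 𝕜]

/-- `u ∈ L²_loc[0,∞)`. -/
def IsL2Loc (u : ℝ → 𝕜) : Prop := ∀ τ : ℝ, 0 < τ → MemLp u 2 (volume.restrict (Ioc 0 τ))

/-- `W = (w, w_t) ∈ C([0,∞); ℍ)` is a solution of the abstract differential equation
`W' = 𝔸 W - 𝔹₁((q + 1) w(0,t)) + 𝔹₂(f(W) + u + d)`, `W(0) = W₀`, in the space `X₋₁`:
the integrated equation holds there for all `t ≥ 0`. -/
structure IsAbstractSolution (q : ℝ) (f : StateSpace 𝕜 → ℝ) (u d : ℝ → 𝕜) (W₀ : StateSpace 𝕜)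
    (W : ℝ → StateSpace 𝕜) : Prop where
  continuousOn : ContinuousOn W (Ici 0)
  initial : W 0 = W₀
  equation : ∀ t : ℝ, 0 ≤ t →
    embed (waveOp 𝕜) (W t) - embed (waveOp 𝕜) W₀ =
      ∫ s in (0 : ℝ)..t, (extendOp (waveOp 𝕜) (W s)
        - controlOp₁ 𝕜 (((q + 1 : ℝ) : 𝕜) * (W s).fst 0)
        + controlOp₂ 𝕜 ((f (W s) : 𝕜) + u s + d s))

/-- `W = (w, w_t) ∈ C([0,∞); ℍ)` is a weak solution of the boundary value problem
`w_tt = w_xx`, `w_x(0,t) = -q w(0,t)`, `w_x(1,t) = u(t) + f(w, w_t) + d(t)`, `W(0) = W₀`: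
the second component of `W` is the time derivative of the first one in `L²(0,1)`, and for every
test function `η ∈ H¹(0,1)` the equation, multiplied by `η` and integrated by parts over `(0,1)`
with the boundary conditions inserted, holds in integrated form in time. -/
structure IsWeakSolution (q : ℝ) (f : StateSpace 𝕜 → ℝ) (u d : ℝ → 𝕜) (W₀ : StateSpace 𝕜)
    (W : ℝ → StateSpace 𝕜) : Prop where
  continuousOn : ContinuousOn W (Ici 0)
  initial : W 0 = W₀
  velocity : ∀ t : ℝ, 0 ≤ t →
    HasDerivWithinAt (fun s => H1.toL2 (W s).fst) (W t).snd (Ici 0) t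
  equation : ∀ η : H1 𝕜, ∀ t : ℝ, 0 ≤ t →
    ⟪H1.toL2 η, (W t).snd⟫_𝕜 - ⟪H1.toL2 η, W₀.snd⟫_𝕜 =
      ∫ s in (0 : ℝ)..t, (-⟪H1.deriv η, H1.deriv (W s).fst⟫_𝕜
        + (q : 𝕜) * (W s).fst 0 * conj (η 0)
        + (u s + (f (W s) : 𝕜) + d s) * conj (η 1))

end Plant

end WaveSystem

/-!
Write `R = 𝔸⁻¹`. It is a bounded, injective, skew-adjoint operator on `ℍ` (`waveInv`; bounded by
the Hellinger-Toeplitz argument), and everything is transported to `ℍ` through it: the extension of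
`𝔸` identifies `ℍ` with a subspace of the extrapolation space that contains `ℍ` as the range of `R`
(`embed_eq_extendOp`) and the control operators as `𝔹ᵢ = 𝔸 βᵢ` with Riesz representatives `βᵢ ∈ ℍ`
of boundary evaluations (`controlOp₁_eq`, `controlOp₂_eq`). An equation in the extrapolation space
thus becomes an equation in `ℍ` between integrals of continuous or integrable functions.

*Unitary group.* The bounded skew-adjoint operators `R (R² - ε)⁻¹` approximate `R⁻¹`; their
exponentials converge strongly to a unitary group generated by `R⁻¹` (`exists_unitaryGroup`,
`IsInverseGenerator.isGenerator`). This works over both scalar fields and needs no spectral theorem.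

*Admissibility.* By duality (`IsInverseGenerator.isAdmissibleInput`) it is enough to bound
`∫ |ψ(x, t)|² dt` at `x = 0, 1` for the orbit `(φ, ψ)` of a point of the domain. The multiplier
`x φ'` gives this at `x = 1`, and the multiplier `φ'` compares the two ends (`observability_one`,
`observability_zero`).

*Semilinear equation.* The linear equation with input `g` has exactly one solution, and the
difference of two solutions with the same initial value satisfies
`‖W(t) - V(t)‖² ≤ C ∫₀ᵗ |g - k|²` (`IsInverseGenerator.exists_linearSolution`,
`IsInverseGenerator.norm_sub_sq_le`). Feeding a Lipschitz function of the state back into the input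
gives a map some iterate of which is a contraction on every bounded time interval; the same
estimate gives uniqueness, and the solutions on bounded intervals fit together
(`IsInverseGenerator.exists_global`, `IsInverseGenerator.eqOn_of_lipschitz`).

*Notions of solution.* Both the abstract and the weak form are equivalent to the transported
equation (`isAbstractSolution_iff`, `isWeakSolution_iff`): its `L²` component says that `w` is a
primitive of `v`, and its `H¹` component, tested with `η ∈ H¹(0,1)`, is the weak equation.
-/

namespace WaveSystem

/-! ### Unitary groups generated by the inverse of a bounded skew-adjoint operator -/

section Stone

variable {𝕜 : Type*} [RCLike 𝕜]
variable {X : Type*} [NormedAddCommGroup X] [InnerProductSpace 𝕜 X]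

theorem commute_exp_apply {A B : X →L[𝕜] X} (h : Commute A B) (x : X) :
    NormedSpace.exp A (B x) = B (NormedSpace.exp A x) :=
  congrArg (fun S : X →L[𝕜] X => S x) h.exp_left.eq

variable [CompleteSpace X]

theorem skew_star {R : X →L[𝕜] X} (hskew : ∀ x y, ⟪R x, y⟫_𝕜 = -⟪x, R y⟫_𝕜) : star R = -R := by
  rw [ContinuousLinearMap.star_eq_adjoint]
  symm
  rw [ContinuousLinearMap.eq_adjoint_iff]
  intro x y
  rw [neg_apply, inner_neg_left, hskew, neg_neg]

/-- A bounded injective skew-adjoint operator has dense range. -/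
theorem skew_denseRange {R : X →L[𝕜] X} (hskew : ∀ x y, ⟪R x, y⟫_𝕜 = -⟪x, R y⟫_𝕜)
    (hinj : Function.Injective R) : DenseRange R := by
  have : Dense ((R : X →ₗ[𝕜] X).range : Set X) := by
    rw [Submodule.dense_iff_topologicalClosure_eq_top, Submodule.topologicalClosure_eq_top_iff,
      Submodule.eq_bot_iff]
    intro z hz
    apply hinj
    have h1 : ⟪R (R z), z⟫_𝕜 = 0 := (Submodule.mem_orthogonal _ _).1 hz _ ⟨R z, rfl⟩
    rw [hskew, neg_eq_zero, inner_self_eq_zero] at h1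
    rw [h1, map_zero]
  exact this

/-- `R² - ε` is negative definite, hence invertible. -/
theorem isUnit_sq_sub {R : X →L[𝕜] X} (hskew : ∀ x y, ⟪R x, y⟫_𝕜 = -⟪x, R y⟫_𝕜) {ε : ℝ}
    (hε : 0 < ε) : IsUnit (R * R - ((ε : ℝ) : 𝕜) • (1 : X →L[𝕜] X)) := by
  refine ContinuousLinearMap.isUnit_of_forall_le_norm_inner_map _ (c := ⟨ε, hε.le⟩) hε fun x => ?_
  have h : ⟪(R * R - ((ε : ℝ) : 𝕜) • (1 : X →L[𝕜] X)) x, x⟫_𝕜 =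
      ((-(‖R x‖ ^ 2 + ε * ‖x‖ ^ 2) : ℝ) : 𝕜) := by
    change ⟪R (R x) - ((ε : ℝ) : 𝕜) • x, x⟫_𝕜 = _
    rw [inner_sub_left, inner_smul_left, RCLike.conj_ofReal, hskew, inner_self_eq_norm_sq_to_K,
      inner_self_eq_norm_sq_to_K]
    push_cast
    ring
  rw [h, RCLike.norm_ofReal, abs_neg, abs_of_nonneg (by positivity)]
  change ‖x‖ ^ 2 * ε ≤ _
  nlinarith [sq_nonneg ‖R x‖]

/-- Yosida approximation: the unbounded operator `R⁻¹` is approximated by the bounded operators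
`R (R² - ε)⁻¹`, which are skew-adjoint, commute with each other and with `R`, and converge to
`R⁻¹` on the range of `R`. -/
theorem exists_yosida {R : X →L[𝕜] X} (hskew : ∀ x y, ⟪R x, y⟫_𝕜 = -⟪x, R y⟫_𝕜)
    (hinj : Function.Injective R) :
    ∃ A : ℕ → X →L[𝕜] X, (∀ n, star (A n) = -A n) ∧ (∀ n m, Commute (A n) (A m)) ∧
      (∀ n, Commute (A n) R) ∧ ∀ y, Tendsto (fun n => A n (R y)) atTop (𝓝 y) := by
  let ε : ℕ → ℝ := fun n => 1 / ((n : ℝ) + 1)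
  have hε : ∀ n, 0 < ε n := fun n => Nat.one_div_pos_of_nat
  let D : ℕ → X →L[𝕜] X := fun n => R * R - ((ε n : ℝ) : 𝕜) • (1 : X →L[𝕜] X)
  have hD : ∀ n, IsUnit (D n) := fun n => isUnit_sq_sub hskew (hε n)
  let G : ℕ → X →L[𝕜] X := fun n => Ring.inverse (D n)
  have hDG : ∀ n, D n * G n = 1 := fun n => Ring.mul_inverse_cancel _ (hD n)
  have hGD : ∀ n, G n * D n = 1 := fun n => Ring.inverse_mul_cancel _ (hD n)
  have hRD : ∀ n, Commute R (D n) := fun n =>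
    ((Commute.refl R).mul_right (Commute.refl R)).sub_right ((Commute.one_right R).smul_right _)
  have hDD : ∀ n m, Commute (D n) (D m) := fun n m =>
    ((hRD n).symm.mul_right (hRD n).symm).sub_right ((Commute.one_right _).smul_right _)
  have hGG : ∀ n m, Commute (G n) (G m) := fun n m => (hDD n m).ringInverse_ringInverse
  have hRG : ∀ n, Commute R (G n) := fun n => by
    change R * G n = G n * R
    calc R * G n = (G n * D n) * (R * G n) := by rw [hGD, one_mul]
      _ = G n * (R * D n) * G n := by rw [(hRD n).eq]; simp only [mul_assoc]
      _ = G n * R := by rw [mul_assoc, mul_assoc, hDG, mul_one]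
  have hstarD : ∀ n, star (D n) = D n := fun n => by
    simp only [D, star_sub, star_mul, star_smul, star_one, skew_star hskew, neg_mul_neg,
      RCLike.star_def, RCLike.conj_ofReal]
  have hstarG : ∀ n, star (G n) = G n := fun n => by
    simp only [G]
    rw [← Ring.inverse_star, hstarD]
  refine ⟨fun n => R * G n, fun n => ?_, fun n m => ?_, fun n => ?_, fun y => ?_⟩
  · change star (R * G n) = -(R * G n)
    rw [star_mul, hstarG, skew_star hskew, mul_neg, (hRG n).eq]
  · exact (((Commute.refl R).mul_right (hRG m))).mul_left (((hRG n).symm).mul_right (hGG n m))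
  · exact (Commute.refl R).mul_left (hRG n).symm
  -- the error `R (R² - ε)⁻¹ R y - y = ε (R² - ε)⁻¹ y` is at most `‖y‖`, and tends to `0` for
  -- `y` in the dense range of `R²`
  have hDx : ∀ n x, D n x = R (R x) - ((ε n : ℝ) : 𝕜) • x := fun n x => rfl
  have herr : ∀ n x, R (G n (R x)) - x = ((ε n : ℝ) : 𝕜) • G n x := fun n x => by
    have h1 : G n (R x) = R (G n x) := congrArg (fun S : X →L[𝕜] X => S x) (hRG n).eq.symm
    have h2 : D n (G n x) = x := congrArg (fun S : X →L[𝕜] X => S x) (hDG n)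
    rw [hDx] at h2
    rw [h1]
    nth_rewrite 2 [← h2]
    abel
  have hbd : ∀ n x, ‖((ε n : ℝ) : 𝕜) • G n x‖ ≤ ‖x‖ := fun n x => by
    set g := G n x
    have h2 : D n g = x := congrArg (fun S : X →L[𝕜] X => S x) (hDG n)
    have h3 : ε n * ‖g‖ ^ 2 ≤ ‖x‖ * ‖g‖ := by
      refine le_trans ?_ (norm_inner_le_norm (𝕜 := 𝕜) x g)
      refine le_trans ?_ (RCLike.abs_re_le_norm _)
      rw [← h2, hDx, inner_sub_left, hskew, inner_smul_left, RCLike.conj_ofReal,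
        inner_self_eq_norm_sq_to_K, inner_self_eq_norm_sq_to_K]
      have e : (-((‖R g‖ : ℝ) : 𝕜) ^ 2 - ((ε n : ℝ) : 𝕜) * ((‖g‖ : ℝ) : 𝕜) ^ 2) =
          ((-(‖R g‖ ^ 2 + ε n * ‖g‖ ^ 2) : ℝ) : 𝕜) := by
        push_cast
        ring
      rw [e, RCLike.ofReal_re, abs_neg]
      exact le_trans (by nlinarith [sq_nonneg ‖R g‖]) (le_abs_self _)
    rw [norm_smul, RCLike.norm_ofReal, abs_of_pos (hε n)]
    rcases (norm_nonneg g).eq_or_lt with h | h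
    · rw [← h, mul_zero]
      exact norm_nonneg _
    · exact le_of_mul_le_mul_right (by linarith) h
  have hε0 : Tendsto ε atTop (𝓝 0) := tendsto_one_div_add_atTop_nhds_zero_nat
  have hdense : DenseRange fun x => R (R x) :=
    (skew_denseRange hskew hinj).comp (skew_denseRange hskew hinj) R.continuous
  rw [← tendsto_sub_nhds_zero_iff, Metric.tendsto_atTop]
  intro δ hδ
  obtain ⟨x, hx⟩ := Metric.denseRange_iff.1 hdense y (δ / 2) (by positivity)
  rw [dist_eq_norm] at hx
  have h0 : Tendsto (fun n => ε n * (2 * ‖x‖)) atTop (𝓝 0) := by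
    simpa using hε0.mul_const (2 * ‖x‖)
  obtain ⟨N, hN⟩ := Metric.tendsto_atTop.1 h0 (δ / 2) (by positivity)
  refine ⟨N, fun n hn => ?_⟩
  have h1 := hN n hn
  rw [dist_zero_right, Real.norm_eq_abs] at h1
  have h2 := (le_abs_self _).trans_lt h1
  rw [dist_zero_right]
  change ‖R (G n (R y)) - y‖ < δ
  rw [herr]
  have h3 : ((ε n : ℝ) : 𝕜) • G n (R (R x)) =
      ((ε n : ℝ) : 𝕜) • (x + ((ε n : ℝ) : 𝕜) • G n x) := by
    congr 1
    have h4 : G n (D n x) = x := congrArg (fun S : X →L[𝕜] X => S x) (hGD n)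
    rw [hDx, map_sub, map_smul] at h4
    rw [← eq_add_of_sub_eq h4]
  have h5 : ‖((ε n : ℝ) : 𝕜) • G n (R (R x))‖ ≤ ε n * (2 * ‖x‖) := by
    rw [h3, norm_smul, RCLike.norm_ofReal, abs_of_pos (hε n)]
    refine mul_le_mul_of_nonneg_left ?_ (hε n).le
    linarith [norm_add_le x (((ε n : ℝ) : 𝕜) • G n x), hbd n x]
  calc ‖((ε n : ℝ) : 𝕜) • G n y‖
      = ‖((ε n : ℝ) : 𝕜) • G n (y - R (R x)) + ((ε n : ℝ) : 𝕜) • G n (R (R x))‖ := by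
        rw [← smul_add, ← map_add, sub_add_cancel]
    _ ≤ ‖y - R (R x)‖ + ε n * (2 * ‖x‖) :=
        (norm_add_le _ _).trans (add_le_add (hbd n _) h5)
    _ < δ := by linarith

theorem skew_exp_mem_unitary {A : X →L[𝕜] X} (hA : star A = -A) (t : ℝ) :
    NormedSpace.exp ((t : 𝕜) • A) ∈ unitary (X →L[𝕜] X) := by
  let _ : NormedAlgebra ℚ (X →L[𝕜] X) := NormedAlgebra.restrictScalars ℚ 𝕜 _
  refine NormedSpace.exp_mem_unitary_of_mem_skewAdjoint ?_
  rw [skewAdjoint.mem_iff, star_smul, hA, smul_neg, RCLike.star_def, RCLike.conj_ofReal]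

theorem norm_skew_exp {A : X →L[𝕜] X} (hA : star A = -A) (t : ℝ) (x : X) :
    ‖NormedSpace.exp ((t : 𝕜) • A) x‖ = ‖x‖ :=
  ContinuousLinearMap.norm_map_of_mem_unitary (skew_exp_mem_unitary hA t) x

theorem exp_add_apply {A B : X →L[𝕜] X} (h : Commute A B) (x : X) :
    NormedSpace.exp (A + B) x = NormedSpace.exp A (NormedSpace.exp B x) := by
  let _ : NormedAlgebra ℚ (X →L[𝕜] X) := NormedAlgebra.restrictScalars ℚ 𝕜 _
  rw [NormedSpace.exp_add_of_commute h]
  rfl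

variable [NormedSpace ℝ X] [IsScalarTower ℝ 𝕜 X]

theorem hasDerivAt_exp_apply (A : X →L[𝕜] X) (x : X) (t : ℝ) :
    HasDerivAt (fun s : ℝ => NormedSpace.exp ((s : 𝕜) • A) x)
      (NormedSpace.exp ((t : 𝕜) • A) (A x)) t := by
  have h1 : HasDerivAt (fun u : 𝕜 => NormedSpace.exp (u • A) x)
      (NormedSpace.exp ((t : 𝕜) • A) (A x)) (t : 𝕜) := by
    simpa using (hasDerivAt_exp_smul_const A (t : 𝕜)).clm_apply (hasDerivAt_const (t : 𝕜) x)
  have h2 := (h1.hasFDerivAt.restrictScalars ℝ).comp_hasDerivAt t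
    (RCLike.ofRealCLM (K := 𝕜)).hasDerivAt
  rw [ContinuousLinearMap.coe_restrictScalars', RCLike.ofRealCLM_apply, RCLike.ofReal_one,
    ContinuousLinearMap.toSpanSingleton_apply, one_smul] at h2
  exact h2

/-- The orbit of `x` moves with speed `‖A x‖`. -/
theorem norm_skew_exp_sub_le {A : X →L[𝕜] X} (hA : star A = -A) (t : ℝ) (x : X) :
    ‖NormedSpace.exp ((t : 𝕜) • A) x - x‖ ≤ ‖A x‖ * |t| := by
  have h := convex_univ.norm_image_sub_le_of_norm_hasDerivWithin_le
    (fun s _ => (hasDerivAt_exp_apply A x s).hasDerivWithinAt)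
    (fun s _ => (norm_skew_exp hA s (A x)).le) (mem_univ (0 : ℝ)) (mem_univ t)
  simpa using h

/-- Stone's theorem for an operator with bounded inverse: if `R` is bounded, injective and
skew-adjoint, then `R⁻¹` generates a strongly continuous unitary group. -/
theorem exists_unitaryGroup {R : X →L[𝕜] X} (hskew : ∀ x y, ⟪R x, y⟫_𝕜 = -⟪x, R y⟫_𝕜)
    (hinj : Function.Injective R) :
    ∃ T : UnitaryGroup 𝕜 X, (∀ t x, T t (R x) = R (T t x)) ∧
      ∀ t x, T t (R x) - R x = ∫ s in (0 : ℝ)..t, T s x := by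
  obtain ⟨A, hA, hAA, hAR, hlim⟩ := exists_yosida hskew hinj
  let U : ℕ → ℝ → X →L[𝕜] X := fun n t => NormedSpace.exp ((t : 𝕜) • A n)
  have hUn : ∀ n t x, ‖U n t x‖ = ‖x‖ := fun n t x => norm_skew_exp (hA n) t x
  have hUadd : ∀ n s t x, U n (s + t) x = U n s (U n t x) := fun n s t x => by
    change NormedSpace.exp (((s + t : ℝ) : 𝕜) • A n) x = _
    rw [RCLike.ofReal_add, add_smul]
    exact exp_add_apply (((Commute.refl (A n)).smul_left _).smul_right _) x
  have hU0 : ∀ n x, U n 0 x = x := fun n x => by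
    simp [U]
  have hUR : ∀ n t x, U n t (R x) = R (U n t x) := fun n t x =>
    commute_exp_apply ((hAR n).smul_left _) x
  -- `U n` and `U m` commute, and `U m (-t) ∘ U n t` is the exponential of `t (A n - A m)`
  have hdiff : ∀ n m t x, ‖U n t x - U m t x‖ ≤ ‖A n x - A m x‖ * |t| := fun n m t x => by
    have hAnm : star (A n - A m) = -(A n - A m) := by
      rw [star_sub, hA, hA]
      abel
    have h1 : U n t x = U m t (NormedSpace.exp ((t : 𝕜) • (A n - A m)) x) := by
      change NormedSpace.exp ((t : 𝕜) • A n) x = _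
      rw [← exp_add_apply, ← smul_add, add_sub_cancel]
      exact ((((hAA m n).sub_right (Commute.refl _)).smul_left _).smul_right _)
    rw [h1, ← map_sub, hUn]
    exact norm_skew_exp_sub_le hAnm t x
  have hcauchy : ∀ t x, CauchySeq fun n => U n t x := fun t x => by
    rw [Metric.cauchySeq_iff']
    intro δ hδ
    obtain ⟨y, hy⟩ := Metric.denseRange_iff.1 (skew_denseRange hskew hinj) x (δ / 4) (by positivity)
    rw [dist_eq_norm] at hy
    obtain ⟨N, hN⟩ := Metric.cauchySeq_iff'.1 (hlim y).cauchySeq (δ / (4 * (|t| + 1)))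
      (by positivity)
    refine ⟨N, fun n hn => ?_⟩
    have h1 := hN n hn
    rw [dist_eq_norm] at h1 ⊢
    have h2 : ‖A n (R y) - A N (R y)‖ * |t| ≤ δ / 4 := by
      calc ‖A n (R y) - A N (R y)‖ * |t| ≤ δ / (4 * (|t| + 1)) * (|t| + 1) := by
            gcongr
            linarith
        _ = δ / 4 := by field_simp
    have e : U n t x - U N t x = U n t (x - R y) - U N t (x - R y) +
        (U n t (R y) - U N t (R y)) := by
      rw [map_sub, map_sub]
      abel
    rw [e]
    have h3 := norm_add_le (U n t (x - R y) - U N t (x - R y)) (U n t (R y) - U N t (R y))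
    have h4 := norm_sub_le (U n t (x - R y)) (U N t (x - R y))
    rw [hUn, hUn] at h4
    have h5 := hdiff n N t (R y)
    linarith
  choose S hS using fun t x => cauchySeq_tendsto_of_complete (hcauchy t x)
  have hSadd : ∀ t x y, S t (x + y) = S t x + S t y := fun t x y =>
    tendsto_nhds_unique (hS t (x + y)) (by simpa using (hS t x).add (hS t y))
  have hSsmul : ∀ t (c : 𝕜) x, S t (c • x) = c • S t x := fun t c x =>
    tendsto_nhds_unique (hS t (c • x)) (by simpa using (hS t x).const_smul c)
  have hSn : ∀ t x, ‖S t x‖ = ‖x‖ := fun t x =>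
    tendsto_nhds_unique (hS t x).norm (by simp only [hUn]; exact tendsto_const_nhds)
  have hS0 : ∀ x, S 0 x = x := fun x =>
    tendsto_nhds_unique (hS 0 x) (by simp only [hU0]; exact tendsto_const_nhds)
  have hSS : ∀ s t x, S (s + t) x = S s (S t x) := fun s t x => by
    refine tendsto_nhds_unique (hS (s + t) x) ?_
    have h1 : Tendsto (fun n => U n s (U n t x - S t x)) atTop (𝓝 0) := by
      rw [tendsto_zero_iff_norm_tendsto_zero]
      simp only [hUn]
      rw [← tendsto_zero_iff_norm_tendsto_zero]
      simpa using (hS t x).sub_const (S t x)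
    have h2 := h1.add (hS s (S t x))
    rw [zero_add] at h2
    refine h2.congr fun n => ?_
    rw [hUadd, map_sub, sub_add_cancel]
  have hSR : ∀ t x, S t (R x) = R (S t x) := fun t x => by
    refine tendsto_nhds_unique (hS t (R x)) ?_
    refine ((R.continuous.tendsto _).comp (hS t x)).congr fun n => ?_
    exact (hUR n t x).symm
  have hSsub : ∀ t x y, S t x - S t y = S t (x - y) := fun t x y => by
    rw [sub_eq_iff_eq_add, ← hSadd, sub_add_cancel]
  -- on the range of `R` the orbits are Lipschitz in time
  have hlip : ∀ y s t, ‖S t (R y) - S s (R y)‖ ≤ ‖y‖ * |t - s| := fun y s t => by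
    have e : S t (R y) = S s (S (t - s) (R y)) := by rw [← hSS, add_sub_cancel]
    rw [e, hSsub, hSn]
    refine le_of_tendsto_of_tendsto ((hS (t - s) (R y)).sub_const (R y)).norm
      ((hlim y).norm.mul_const _) (Eventually.of_forall fun n => ?_)
    exact norm_skew_exp_sub_le (hA n) (t - s) (R y)
  have hcont : ∀ x, Continuous fun t => S t x := fun x => by
    rw [Metric.continuous_iff]
    intro s δ hδ
    obtain ⟨y, hy⟩ := Metric.denseRange_iff.1 (skew_denseRange hskew hinj) x (δ / 4) (by positivity)
    rw [dist_eq_norm] at hy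
    refine ⟨δ / (4 * (‖y‖ + 1)), by positivity, fun t ht => ?_⟩
    rw [Real.dist_eq] at ht
    rw [dist_eq_norm]
    have h2 : ‖y‖ * |t - s| ≤ δ / 4 := by
      calc ‖y‖ * |t - s| ≤ (‖y‖ + 1) * (δ / (4 * (‖y‖ + 1))) := by
            gcongr
            linarith
        _ = δ / 4 := by field_simp
    have e : S t x - S s x = S t (x - R y) - S s (x - R y) + (S t (R y) - S s (R y)) := by
      rw [← hSsub, ← hSsub]
      abel
    rw [e]
    have h3 := norm_add_le (S t (x - R y) - S s (x - R y)) (S t (R y) - S s (R y))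
    have h4 := norm_sub_le (S t (x - R y)) (S s (x - R y))
    rw [hSn, hSn] at h4
    have h5 := hlip y s t
    linarith
  let T : UnitaryGroup 𝕜 X :=
    { toFun := fun t =>
        { toFun := S t
          map_add' := hSadd t
          map_smul' := hSsmul t
          invFun := S (-t)
          left_inv := fun x => by rw [← hSS, neg_add_cancel, hS0]
          right_inv := fun x => by
            rw [← hSS, add_neg_cancel, hS0]
          norm_map' := hSn t }
      map_zero' := hS0
      map_add' := hSS
      continuous' := hcont }
  refine ⟨T, hSR, fun t y => ?_⟩
  change S t (R y) - R y = ∫ s in (0 : ℝ)..t, S s y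
  have hUcont : ∀ n x, Continuous fun s => U n s x := fun n x =>
    continuous_iff_continuousAt.2 fun s => (hasDerivAt_exp_apply (A n) x s).continuousAt
  have h1 : ∀ n, U n t (R y) - R y = ∫ s in (0 : ℝ)..t, U n s (A n (R y)) := fun n => by
    rw [intervalIntegral.integral_eq_sub_of_hasDerivAt
      (fun s _ => hasDerivAt_exp_apply (A n) (R y) s) ((hUcont n _).intervalIntegrable _ _)]
    change _ = U n t (R y) - U n 0 (R y)
    rw [hU0]
  obtain ⟨C, hC⟩ := (hlim y).norm.bddAbove_range
  refine tendsto_nhds_unique ((hS t (R y)).sub_const (R y)) ?_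
  simp only [h1]
  refine intervalIntegral.tendsto_integral_filter_of_dominated_convergence (fun _ => C)
    (Eventually.of_forall fun n => (hUcont n _).aestronglyMeasurable)
    (Eventually.of_forall fun n => Eventually.of_forall fun s _ => ?_)
    intervalIntegrable_const (Eventually.of_forall fun s _ => ?_)
  · rw [hUn]
    exact hC ⟨n, rfl⟩
  · have h2 : Tendsto (fun n => U n s (A n (R y) - y)) atTop (𝓝 0) := by
      rw [tendsto_zero_iff_norm_tendsto_zero]
      simp only [hUn]
      rw [← tendsto_zero_iff_norm_tendsto_zero]
      simpa using (hlim y).sub_const y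
    have h3 := h2.add (hS s y)
    rw [zero_add] at h3
    refine h3.congr fun n => ?_
    rw [map_sub, sub_add_cancel]

end Stone

/-! ### The linear inhomogeneous equation -/

/-- Fubini's theorem on the triangle `0 < r ≤ s ≤ t`. -/
theorem integral_triangle_swap {E : Type*} [NormedAddCommGroup E] [NormedSpace ℝ E]
    {f : ℝ → ℝ → E} {t : ℝ} (ht : 0 ≤ t)
    (hf : Integrable (Function.uncurry f)
      ((volume.restrict (Ioc 0 t)).prod (volume.restrict (Ioc 0 t)))) :
    ∫ s in (0 : ℝ)..t, ∫ r in (0 : ℝ)..s, f s r = ∫ r in (0 : ℝ)..t, ∫ s in r..t, f s r := by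
  have hS : MeasurableSet {p : ℝ × ℝ | p.2 ≤ p.1} :=
    measurableSet_le measurable_snd measurable_fst
  have key := integral_integral_swap
    (f := fun s r => {p : ℝ × ℝ | p.2 ≤ p.1}.indicator (Function.uncurry f) (s, r))
    (hf.indicator hS)
  rw [intervalIntegral.integral_of_le ht, intervalIntegral.integral_of_le ht]
  have e1 : ∀ s ∈ Ioc 0 t, ∫ r in (0 : ℝ)..s, f s r =
      ∫ r in Ioc 0 t, {p : ℝ × ℝ | p.2 ≤ p.1}.indicator (Function.uncurry f) (s, r) := by
    intro s hs
    have : (fun r => {p : ℝ × ℝ | p.2 ≤ p.1}.indicator (Function.uncurry f) (s, r)) =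
        (Iic s).indicator (f s) := by
      funext r
      simp [indicator]
    rw [this, integral_indicator measurableSet_Iic, Measure.restrict_restrict measurableSet_Iic,
      intervalIntegral.integral_of_le hs.1.le]
    congr 2
    ext r
    simp only [mem_Ioc, mem_inter_iff, mem_Iic]
    exact ⟨fun h => ⟨h.2, h.1, h.2.trans hs.2⟩, fun h => ⟨h.2.1, h.1⟩⟩
  have e2 : ∀ r ∈ Ioc 0 t, ∫ s in r..t, f s r =
      ∫ s in Ioc 0 t, {p : ℝ × ℝ | p.2 ≤ p.1}.indicator (Function.uncurry f) (s, r) := by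
    intro r hr
    have : (fun s => {p : ℝ × ℝ | p.2 ≤ p.1}.indicator (Function.uncurry f) (s, r)) =
        (Ici r).indicator (fun s => f s r) := by
      funext s
      simp [indicator]
    rw [this, integral_indicator measurableSet_Ici, Measure.restrict_restrict measurableSet_Ici,
      intervalIntegral.integral_of_le hr.2, ← integral_Icc_eq_integral_Ioc]
    congr 2
    ext s
    simp only [mem_Ioc, mem_inter_iff, mem_Ici, mem_Icc]
    exact ⟨fun h => ⟨h.1, hr.1.trans_le h.1, h.2⟩, fun h => ⟨h.1, h.2.2⟩⟩
  rw [setIntegral_congr_fun measurableSet_Ioc e1, setIntegral_congr_fun measurableSet_Ioc e2]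
  exact key

theorem intervalIntegrable_of_mem_Icc {E : Type*} [NormedAddCommGroup E] {N t : ℝ} {h : ℝ → E}
    (hh : IntegrableOn h (Ioc 0 N)) (ht : t ∈ Icc 0 N) : IntervalIntegrable h volume 0 t :=
  (intervalIntegrable_iff_integrableOn_Ioc_of_le ht.1).2 (hh.mono_set (Ioc_subset_Ioc_right ht.2))

theorem integrableOn_Ioc_of_continuousOn {E : Type*} [NormedAddCommGroup E] {a c : ℝ}
    {W : ℝ → E} (hW : ContinuousOn W (Icc a c)) : IntegrableOn W (Ioc a c) :=
  (hW.integrableOn_Icc).mono_set Ioc_subset_Icc_self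

section Cauchy

variable {𝕜 : Type*} [RCLike 𝕜]
variable {X : Type*} [NormedAddCommGroup X] [InnerProductSpace 𝕜 X]

theorem UnitaryGroup.continuous_uncurry (T : UnitaryGroup 𝕜 X) :
    Continuous fun p : ℝ × X => T p.1 p.2 := by
  have : Continuous fun p : X × ℝ => T p.2 p.1 :=
    continuous_prod_of_continuous_lipschitzWith _ 1 (fun x => T.continuous' x)
      fun t => (T t).isometry.lipschitz
  exact this.comp continuous_swap

theorem UnitaryGroup.apply_neg_apply (T : UnitaryGroup 𝕜 X) (t : ℝ) (x : X) :
    T t (T (-t) x) = x := by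
  rw [← T.map_add', add_neg_cancel, T.map_zero']

theorem UnitaryGroup.inner_neg_apply (T : UnitaryGroup 𝕜 X) (t : ℝ) (x y : X) :
    ⟪T (-t) x, y⟫_𝕜 = ⟪x, T t y⟫_𝕜 := by
  rw [← LinearIsometryEquiv.inner_map_map (T t), T.apply_neg_apply]

theorem UnitaryGroup.integrable_comp (T : UnitaryGroup 𝕜 X) {α : Type*} [MeasurableSpace α]
    {μ : Measure α} {c : α → ℝ} {h : α → X} (hc : AEMeasurable c μ) (hh : Integrable h μ) :
    Integrable (fun a => T (c a) (h a)) μ := by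
  refine hh.mono (T.continuous_uncurry.comp_aestronglyMeasurable
    (hc.aestronglyMeasurable.prodMk hh.1)) (Eventually.of_forall fun a => ?_)
  rw [LinearIsometryEquiv.norm_map]

theorem integrableOn_clm_comp {U : Type*} [NormedAddCommGroup U] [NormedSpace 𝕜 U] (b : U →L[𝕜] X)
    {a c : ℝ} {g : ℝ → U} (hg : MemLp g 2 (volume.restrict (Ioc a c))) :
    IntegrableOn (fun r => b (g r)) (Ioc a c) :=
  b.integrable_comp (hg.integrable (by norm_num))

/-- `W` solves `W' = R⁻¹ W + R⁻¹ h`, `W(0) = W₀` on `[0, N]`, in the integrated form to which `R`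
has been applied. -/
structure IsLinearSolution [NormedSpace ℝ X] (R : X →L[𝕜] X) (N : ℝ) (W₀ : X)
    (h W : ℝ → X) : Prop where
  continuousOn : ContinuousOn W (Icc 0 N)
  equation : ∀ t ∈ Icc 0 N, R (W t) - R W₀ = ∫ s in (0 : ℝ)..t, (W s + h s)

theorem IsLinearSolution.sub [NormedSpace ℝ X] {R : X →L[𝕜] X} {N : ℝ} {W₀ V₀ : X}
    {h k W V : ℝ → X}
    (hW : IsLinearSolution R N W₀ h W) (hV : IsLinearSolution R N V₀ k V)
    (hh : IntegrableOn h (Ioc 0 N)) (hk : IntegrableOn k (Ioc 0 N)) :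
    IsLinearSolution R N (W₀ - V₀) (fun s => h s - k s) (fun s => W s - V s) where
  continuousOn := hW.continuousOn.sub hV.continuousOn
  equation t ht := by
    have i1 : IntervalIntegrable (fun s => W s + h s) volume 0 t :=
      intervalIntegrable_of_mem_Icc ((integrableOn_Ioc_of_continuousOn hW.continuousOn).add hh) ht
    have i2 : IntervalIntegrable (fun s => V s + k s) volume 0 t :=
      intervalIntegrable_of_mem_Icc ((integrableOn_Ioc_of_continuousOn hV.continuousOn).add hk) ht
    have e : R (W t - V t) - R (W₀ - V₀) = (R (W t) - R W₀) - (R (V t) - R V₀) := by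
      rw [map_sub, map_sub]
      abel
    rw [e, hW.equation t ht, hV.equation t ht, ← intervalIntegral.integral_sub i1 i2]
    exact intervalIntegral.integral_congr fun s _ => add_sub_add_comm _ _ _ _

variable [CompleteSpace X]

/-- A vector `y` whose inner products are dominated by `‖R x‖` lies in the range of `R`: by the
Hahn-Banach theorem `R x ↦ ⟪y, x⟫` extends to a bounded functional, which has a Riesz
representative. -/
theorem exists_preimage_of_inner_le {R : X →L[𝕜] X}
    (hskew : ∀ x y, ⟪R x, y⟫_𝕜 = -⟪x, R y⟫_𝕜) (hinj : Function.Injective R) {y : X} {C : ℝ}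
    (hC : 0 ≤ C) (h : ∀ x, ‖⟪y, x⟫_𝕜‖ ≤ C * ‖R x‖) : ∃ z, R z = y ∧ ‖z‖ ≤ C := by
  let e := LinearEquiv.ofInjective (R : X →ₗ[𝕜] X) hinj
  have he : ∀ w, R (e.symm w) = w := fun w => congrArg Subtype.val (e.apply_symm_apply w)
  let f : StrongDual 𝕜 (R : X →ₗ[𝕜] X).range :=
    LinearMap.mkContinuous ((innerₛₗ 𝕜 y).comp e.symm.toLinearMap) C fun w => by
      have := h (e.symm w)
      rw [he] at this
      exact this
  obtain ⟨g, hg, hgn⟩ := exists_extension_norm_eq _ f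
  refine ⟨-(InnerProductSpace.toDual 𝕜 X).symm g, ?_, ?_⟩
  · refine ext_inner_right 𝕜 fun x => ?_
    rw [hskew, inner_neg_left, neg_neg, InnerProductSpace.toDual_symm_apply]
    refine (hg (e x)).trans ?_
    change ⟪y, e.symm (e x)⟫_𝕜 = _
    rw [LinearEquiv.symm_apply_apply]
  · rw [norm_neg, LinearIsometryEquiv.norm_map, hgn]
    exact LinearMap.mkContinuous_norm_le _ hC _

variable [NormedSpace ℝ X]

/-- The bounded skew-adjoint operator `R` is the inverse of the generator of `T`. -/
structure IsInverseGenerator (R : X →L[𝕜] X) (T : UnitaryGroup 𝕜 X) : Prop where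
  skew : ∀ x y, ⟪R x, y⟫_𝕜 = -⟪x, R y⟫_𝕜
  injective : Function.Injective R
  comm : ∀ t x, T t (R x) = R (T t x)
  integral : ∀ t x, T t (R x) - R x = ∫ s in (0 : ℝ)..t, T s x

/-- The variation of constants formula, integrated: `s ↦ R ∫₀ˢ T(s - r) h(r) dr` has derivative
`∫₀ˢ T(s - r) h(r) dr + R h(s)`. -/
theorem IsInverseGenerator.convolution {R : X →L[𝕜] X} {T : UnitaryGroup 𝕜 X}
    (H : IsInverseGenerator R T) {h : ℝ → X} {t : ℝ} (ht : 0 ≤ t)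
    (hh : IntegrableOn h (Ioc 0 t)) :
    T t (R (∫ r in (0 : ℝ)..t, T (-r) (h r))) =
      (∫ s in (0 : ℝ)..t, T s (∫ r in (0 : ℝ)..s, T (-r) (h r))) +
        R (∫ r in (0 : ℝ)..t, h r) := by
  have hhi : IntervalIntegrable h volume 0 t :=
    (intervalIntegrable_iff_integrableOn_Ioc_of_le ht).2 hh
  have hTi : IntervalIntegrable (fun r => T (-r) (h r)) volume 0 t :=
    (intervalIntegrable_iff_integrableOn_Ioc_of_le ht).2
      (T.integrable_comp measurable_neg.aemeasurable hh)
  have e1 : T t (R (∫ r in (0 : ℝ)..t, T (-r) (h r))) = ∫ r in (0 : ℝ)..t, T (t - r) (R (h r)) := by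
    rw [← ContinuousLinearMap.intervalIntegral_comp_comm R hTi]
    refine ((T t).toLinearIsometry.intervalIntegral_comp_comm
      (fun r => R (T (-r) (h r)))).symm.trans ?_
    refine intervalIntegral.integral_congr fun r _ => ?_
    change T t (R (T (-r) (h r))) = _
    rw [← H.comm, ← T.map_add', ← sub_eq_add_neg]
  have e2 : ∀ r, T (t - r) (R (h r)) = (∫ s in r..t, T (s - r) (h r)) + R (h r) := fun r => by
    rw [intervalIntegral.integral_comp_sub_right (fun s => T s (h r)), sub_self, ← H.integral,
      sub_add_cancel]
  have e3 : ∫ s in (0 : ℝ)..t, T s (∫ r in (0 : ℝ)..s, T (-r) (h r)) =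
      ∫ r in (0 : ℝ)..t, ∫ s in r..t, T (s - r) (h r) := by
    rw [← integral_triangle_swap (f := fun s r => T (s - r) (h r)) ht]
    · refine intervalIntegral.integral_congr fun s _ => ?_
      refine ((T s).toLinearIsometry.intervalIntegral_comp_comm (fun r => T (-r) (h r))).symm.trans
        ?_
      refine intervalIntegral.integral_congr fun r _ => ?_
      change T s (T (-r) (h r)) = _
      rw [← T.map_add', ← sub_eq_add_neg]
    · exact T.integrable_comp (measurable_fst.sub measurable_snd).aemeasurable (hh.comp_snd _)
  have hRi : IntervalIntegrable (fun r => R (h r)) volume 0 t :=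
    ⟨R.integrable_comp hhi.1, R.integrable_comp hhi.2⟩
  have hT2 : IntervalIntegrable (fun r => T (t - r) (R (h r))) volume 0 t :=
    (intervalIntegrable_iff_integrableOn_Ioc_of_le ht).2
      (T.integrable_comp (measurable_const.sub measurable_id).aemeasurable (R.integrable_comp hh))
  rw [e1, e3, ← ContinuousLinearMap.intervalIntegral_comp_comm R hhi,
    ← intervalIntegral.integral_add _ hRi]
  · exact intervalIntegral.integral_congr fun r _ => e2 r
  · refine (hT2.sub hRi).congr fun r _ => ?_
    rw [e2, add_sub_cancel_right]

/-- `b` is an admissible input operator in the following transported and quantitative sense: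
the integral `∫ T(-r) b g(r) dr` over a bounded interval lies in the range of `R`, and its preimage
is controlled by the `L²` norm of `g`. Here `b` stands for the control operator `R⁻¹ b`. -/
def IsAdmissibleInput {U : Type*} [NormedAddCommGroup U] [NormedSpace 𝕜 U] (R : X →L[𝕜] X)
    (T : UnitaryGroup 𝕜 X) (b : U →L[𝕜] X) (K : ℝ) : Prop :=
  ∀ a c : ℝ, a ≤ c → ∀ g : ℝ → U, MemLp g 2 (volume.restrict (Ioc a c)) →
    ∃ z : X, R z = ∫ r in a..c, T (-r) (b (g r)) ∧
      ‖z‖ ^ 2 ≤ K * (c - a + 2) * ∫ r in a..c, ‖g r‖ ^ 2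

/-- Duality between admissibility and observability: an estimate for the output
`t ↦ ⟪β, T(t) x⟫` makes `β` an admissible input. -/
theorem IsInverseGenerator.isAdmissibleInput {R : X →L[𝕜] X} {T : UnitaryGroup 𝕜 X}
    (H : IsInverseGenerator R T) {β : X} {K : ℝ} (hK : 0 ≤ K)
    (hobs : ∀ a c : ℝ, a ≤ c → ∀ x,
      ∫ r in a..c, ‖⟪β, T r x⟫_𝕜‖ ^ 2 ≤ K * (c - a + 2) * ‖R x‖ ^ 2) :
    IsAdmissibleInput R T (ContinuousLinearMap.toSpanSingleton 𝕜 β) K := by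
  intro a c hac g hg
  have hgi := integrableOn_clm_comp (ContinuousLinearMap.toSpanSingleton 𝕜 β) hg
  have hTi := T.integrable_comp (c := fun r => -r) measurable_neg.aemeasurable hgi
  have hG : 0 ≤ ∫ r in a..c, ‖g r‖ ^ 2 :=
    intervalIntegral.integral_nonneg hac fun _ _ => by positivity
  have hKG : 0 ≤ K * (c - a + 2) * ∫ r in a..c, ‖g r‖ ^ 2 :=
    mul_nonneg (mul_nonneg hK (by linarith)) hG
  obtain ⟨z, hz, hzn⟩ := exists_preimage_of_inner_le H.skew H.injective
    (y := ∫ r in a..c, T (-r) (ContinuousLinearMap.toSpanSingleton 𝕜 β (g r)))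
    (C := √(K * (c - a + 2) * ∫ r in a..c, ‖g r‖ ^ 2)) (Real.sqrt_nonneg _) (fun x => by
      have hcont : Continuous fun r => ⟪β, T r x⟫_𝕜 := continuous_const.inner (T.continuous' x)
      have hmem : MemLp (fun r => ⟪β, T r x⟫_𝕜) 2 (volume.restrict (Ioc a c)) :=
        MemLp.of_bound hcont.aestronglyMeasurable (‖β‖ * ‖x‖) (Eventually.of_forall fun r => by
          refine (norm_inner_le_norm _ _).trans ?_
          rw [LinearIsometryEquiv.norm_map])
      have e : ⟪x, ∫ r in a..c, T (-r) (ContinuousLinearMap.toSpanSingleton 𝕜 β (g r))⟫_𝕜 =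
          ∫ r in Ioc a c, g r * conj ⟪β, T r x⟫_𝕜 := by
        rw [intervalIntegral.integral_of_le hac, ← integral_inner hTi]
        refine integral_congr_ae (Eventually.of_forall fun r => ?_)
        simp only [ContinuousLinearMap.toSpanSingleton_apply, map_smul, inner_smul_right]
        rw [← inner_conj_symm, T.inner_neg_apply]
      rw [← inner_conj_symm, RCLike.norm_conj, e]
      refine (Real.le_sqrt_of_sq_le (y := (∫ r in Ioc a c, ‖g r‖ ^ 2) *
        (∫ r in Ioc a c, ‖⟪β, T r x⟫_𝕜‖ ^ 2)) ?_).trans ?_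
      · have cs := integral_mul_norm_le_Lp_mul_Lq (μ := volume.restrict (Ioc a c))
          Real.HolderConjugate.two_two (f := g) (g := fun r => ⟪β, T r x⟫_𝕜)
          (by simpa using hg) (by simpa using hmem)
        have h1 : ‖∫ r in Ioc a c, g r * conj ⟪β, T r x⟫_𝕜‖ ≤
            ∫ r in Ioc a c, ‖g r‖ * ‖⟪β, T r x⟫_𝕜‖ := by
          refine (norm_integral_le_integral_norm _).trans_eq ?_
          simp only [norm_mul, RCLike.norm_conj]
        have h2 := h1.trans cs
        simp only [Real.rpow_two, ← Real.sqrt_eq_rpow] at h2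
        calc _ ≤ _ := pow_le_pow_left₀ (norm_nonneg _) h2 2
          _ = _ := by
            rw [mul_pow, Real.sq_sqrt (integral_nonneg fun _ => by positivity),
              Real.sq_sqrt (integral_nonneg fun _ => by positivity)]
      · rw [← Real.sqrt_sq (norm_nonneg (R x)), ← Real.sqrt_mul hKG]
        refine Real.sqrt_le_sqrt ?_
        have h3 := hobs a c hac x
        rw [intervalIntegral.integral_of_le hac] at h3 hG ⊢
        calc _ ≤ (∫ r in Ioc a c, ‖g r‖ ^ 2) * (K * (c - a + 2) * ‖R x‖ ^ 2) :=
              mul_le_mul_of_nonneg_left h3 hG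
          _ = _ := by ring)
  refine ⟨z, hz, ?_⟩
  calc ‖z‖ ^ 2 ≤ _ := pow_le_pow_left₀ (norm_nonneg _) hzn 2
    _ = _ := Real.sq_sqrt hKG

/-- Conservation of `‖R W(t)‖²` gives uniqueness for the homogeneous equation. -/
theorem IsInverseGenerator.eq_zero {R : X →L[𝕜] X} {T : UnitaryGroup 𝕜 X}
    (H : IsInverseGenerator R T) {N : ℝ} {W : ℝ → X}
    (hW : IsLinearSolution R N 0 (fun _ => 0) W) : ∀ t ∈ Icc 0 N, W t = 0 := by
  intro t ht
  have hN : 0 ≤ N := ht.1.trans ht.2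
  let V : ℝ → X := IccExtend hN (fun s : Icc 0 N => W s)
  have hV : Continuous V := (continuousOn_iff_continuous_domRestrict.1 hW.continuousOn).Icc_extend'
  have hVW : ∀ s ∈ Icc 0 N, V s = W s := fun s hs => IccExtend_of_mem hN _ hs
  let y : ℝ → X := fun s => ∫ r in (0 : ℝ)..s, V r
  have hy : ∀ s, HasDerivAt y (V s) s := fun s =>
    intervalIntegral.integral_hasDerivAt_right (hV.intervalIntegrable _ _)
      (hV.stronglyMeasurableAtFilter _ _) hV.continuousAt
  have hyR : ∀ s ∈ Icc 0 N, y s = R (W s) := fun s hs => by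
    have h := hW.equation s hs
    rw [map_zero, sub_zero] at h
    rw [h]
    refine intervalIntegral.integral_congr fun r hr => ?_
    rw [uIcc_of_le hs.1] at hr
    simp only [add_zero]
    exact hVW r ⟨hr.1, hr.2.trans hs.2⟩
  have hd : ∀ s ∈ Ico 0 N, HasDerivWithinAt (fun s => ⟪y s, y s⟫_𝕜) 0 (Ici s) s := by
    intro s hs
    have h := ((hy s).inner 𝕜 (hy s)).hasDerivWithinAt (s := Ici s)
    have hs' : s ∈ Icc 0 N := Ico_subset_Icc_self hs
    rw [hyR s hs', hVW s hs', H.skew, neg_add_cancel] at h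
    exact h
  have hyc : Continuous y := continuous_iff_continuousAt.2 fun s => (hy s).continuousAt
  have h1 := constant_of_has_deriv_right_zero (hyc.inner hyc).continuousOn hd t ht
  simp only [y, intervalIntegral.integral_same, inner_zero_left, inner_self_eq_zero] at h1
  apply H.injective
  rw [map_zero, ← hyR t ht]
  exact h1

variable {U : Type*} [NormedAddCommGroup U] [NormedSpace 𝕜 U]

/-- Existence for the linear equation with an admissible input. -/
theorem IsInverseGenerator.exists_linearSolution {R : X →L[𝕜] X} {T : UnitaryGroup 𝕜 X}
    (H : IsInverseGenerator R T) {b : U →L[𝕜] X} {K : ℝ} (hK : 0 ≤ K)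
    (hb : IsAdmissibleInput R T b K) {N : ℝ} (W₀ : X) {g : ℝ → U}
    (hg : MemLp g 2 (volume.restrict (Ioc 0 N))) :
    ∃ W, IsLinearSolution R N W₀ (fun s => b (g s)) W ∧
      ∀ t ∈ Icc 0 N, ‖W t - T t W₀‖ ^ 2 ≤ K * (N + 2) * ∫ s in (0 : ℝ)..t, ‖g s‖ ^ 2 := by
  have hgm : ∀ {s t}, 0 ≤ s → t ≤ N → MemLp g 2 (volume.restrict (Ioc s t)) := fun hs ht =>
    hg.mono_measure (Measure.restrict_mono (Ioc_subset_Ioc hs ht) le_rfl)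
  have hbg : IntegrableOn (fun s => b (g s)) (Ioc 0 N) := integrableOn_clm_comp b hg
  have hTbg : IntegrableOn (fun s => T (-s) (b (g s))) (Ioc 0 N) :=
    T.integrable_comp measurable_neg.aemeasurable hbg
  have hg2 : IntegrableOn (fun s => ‖g s‖ ^ 2) (Ioc 0 N) := hg.norm.integrable_sq
  -- `Ψ t` stands for `∫₀ᵗ T(-r) R⁻¹ b g(r) dr`, and the solution is `T t (W₀ + Ψ t)`
  have hex : ∀ t, ∃ z : X, t ∈ Icc 0 N → R z = ∫ r in (0 : ℝ)..t, T (-r) (b (g r)) ∧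
      ‖z‖ ^ 2 ≤ K * (t - 0 + 2) * ∫ r in (0 : ℝ)..t, ‖g r‖ ^ 2 := fun t => by
    by_cases ht : t ∈ Icc 0 N
    · obtain ⟨z, hz⟩ := hb 0 t ht.1 g (hgm le_rfl ht.2)
      exact ⟨z, fun _ => hz⟩
    · exact ⟨0, fun h => absurd h ht⟩
  choose Ψ hΨ using hex
  let G : ℝ → ℝ := fun t => ∫ s in (0 : ℝ)..t, ‖g s‖ ^ 2
  have hG0 : ∀ {t}, 0 ≤ t → 0 ≤ G t := fun ht =>
    intervalIntegral.integral_nonneg ht fun _ _ => by positivity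
  have hdiff : ∀ s ∈ Icc 0 N, ∀ t ∈ Icc 0 N, s ≤ t →
      ‖Ψ t - Ψ s‖ ^ 2 ≤ K * (N + 2) * |G t - G s| := by
    intro s hs t ht hst
    obtain ⟨z, hz, hzn⟩ := hb s t hst g (hgm hs.1 ht.2)
    have hz' : z = Ψ t - Ψ s := by
      apply H.injective
      rw [hz, map_sub, (hΨ t ht).1, (hΨ s hs).1]
      exact (intervalIntegral.integral_interval_sub_left (intervalIntegrable_of_mem_Icc hTbg ht)
        (intervalIntegrable_of_mem_Icc hTbg hs)).symm
    have hG : ∫ r in s..t, ‖g r‖ ^ 2 = G t - G s :=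
      (intervalIntegral.integral_interval_sub_left (intervalIntegrable_of_mem_Icc hg2 ht)
        (intervalIntegrable_of_mem_Icc hg2 hs)).symm
    rw [← hz']
    rw [hG] at hzn
    have : 0 ≤ G t - G s := by
      rw [← hG]
      exact intervalIntegral.integral_nonneg hst fun _ _ => by positivity
    rw [abs_of_nonneg this]
    refine hzn.trans (mul_le_mul_of_nonneg_right (mul_le_mul_of_nonneg_left ?_ hK) this)
    linarith [hs.1, ht.2]
  have hdiff' : ∀ s ∈ Icc 0 N, ∀ t ∈ Icc 0 N,
      ‖Ψ t - Ψ s‖ ≤ √(K * (N + 2) * |G t - G s|) := by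
    intro s hs t ht
    refine Real.le_sqrt_of_sq_le ?_
    rcases le_total s t with h | h
    · exact hdiff s hs t ht h
    · rw [norm_sub_rev, abs_sub_comm]
      exact hdiff t ht s hs h
  have hGc : ContinuousOn G (Icc 0 N) := by
    rcases le_or_gt 0 N with hN | hN
    · have := intervalIntegral.continuousOn_primitive_interval'
        (intervalIntegrable_of_mem_Icc hg2 (right_mem_Icc.2 hN)) left_mem_uIcc
      rwa [uIcc_of_le hN] at this
    · simp [Icc_eq_empty hN.not_ge]
  have hΨc : ContinuousOn Ψ (Icc 0 N) := by
    intro s hs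
    change Tendsto Ψ _ _
    rw [tendsto_iff_norm_sub_tendsto_zero]
    have h1 : Tendsto (fun t => √(K * (N + 2) * |G t - G s|)) (𝓝[Icc 0 N] s) (𝓝 0) := by
      have h2 : Tendsto (fun t => G t - G s) (𝓝[Icc 0 N] s) (𝓝 0) := by
        simpa using (hGc s hs).sub_const (G s)
      have h3 := (Real.continuous_sqrt.tendsto _).comp (h2.abs.const_mul (K * (N + 2)))
      rwa [abs_zero, mul_zero, Real.sqrt_zero] at h3
    refine squeeze_zero' (Eventually.of_forall fun _ => norm_nonneg _) ?_ h1
    filter_upwards [self_mem_nhdsWithin] with t ht using hdiff' s hs t ht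
  refine ⟨fun t => T t (W₀ + Ψ t), ⟨?_, fun t ht => ?_⟩, fun t ht => ?_⟩
  · exact T.continuous_uncurry.comp_continuousOn
      (continuousOn_id.prodMk (continuousOn_const.add hΨc))
  · have c1 := H.convolution ht.1 (hbg.mono_set (Ioc_subset_Ioc_right ht.2))
    have c2 : R (T t (W₀ + Ψ t)) = T t (R W₀) + T t (R (Ψ t)) := by
      rw [← H.comm, map_add, map_add]
    have iT : IntervalIntegrable (fun s => T s W₀) volume 0 t :=
      (T.continuous' W₀).intervalIntegrable _ _
    have ibg : IntervalIntegrable (fun s => b (g s)) volume 0 t :=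
      intervalIntegrable_of_mem_Icc hbg ht
    have hTΨ : ContinuousOn (fun s => T s (Ψ s)) (Icc 0 N) :=
      T.continuous_uncurry.comp_continuousOn (continuousOn_id.prodMk hΨc)
    have iTΨ : IntervalIntegrable (fun s => T s (Ψ s)) volume 0 t :=
      intervalIntegrable_of_mem_Icc (integrableOn_Ioc_of_continuousOn hTΨ) ht
    -- `R` is applied once more, since the convolution formula concerns `R ∫ T(t - r) b g(r) dr`
    have c3 : T t (R (Ψ t)) = (∫ s in (0 : ℝ)..t, T s (Ψ s)) + ∫ s in (0 : ℝ)..t, b (g s) := by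
      apply H.injective
      rw [← H.comm, (hΨ t ht).1, c1, map_add,
        ← ContinuousLinearMap.intervalIntegral_comp_comm R iTΨ]
      congr 1
      refine intervalIntegral.integral_congr fun s hs => ?_
      rw [uIcc_of_le ht.1] at hs
      rw [← H.comm, (hΨ s ⟨hs.1, hs.2.trans ht.2⟩).1]
    rw [c2, add_sub_right_comm, H.integral, c3, ← add_assoc, ← intervalIntegral.integral_add iT iTΨ,
      ← intervalIntegral.integral_add (iT.add iTΨ) ibg]
    exact intervalIntegral.integral_congr fun s _ => by simp only [map_add]
  · simp only
    rw [map_add, add_sub_cancel_left, LinearIsometryEquiv.norm_map]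
    refine (hΨ t ht).2.trans (mul_le_mul_of_nonneg_right (mul_le_mul_of_nonneg_left ?_ hK)
      (hG0 ht.1))
    linarith [ht.2]

/-- The energy estimate: solutions depend continuously on the input. -/
theorem IsInverseGenerator.norm_sub_sq_le {R : X →L[𝕜] X} {T : UnitaryGroup 𝕜 X}
    (H : IsInverseGenerator R T) {b : U →L[𝕜] X} {K : ℝ} (hK : 0 ≤ K)
    (hb : IsAdmissibleInput R T b K) {N : ℝ} {W₀ : X} {g k : ℝ → U} {W V : ℝ → X}
    (hg : MemLp g 2 (volume.restrict (Ioc 0 N))) (hk : MemLp k 2 (volume.restrict (Ioc 0 N)))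
    (hW : IsLinearSolution R N W₀ (fun s => b (g s)) W)
    (hV : IsLinearSolution R N W₀ (fun s => b (k s)) V) :
    ∀ t ∈ Icc 0 N, ‖W t - V t‖ ^ 2 ≤ K * (N + 2) * ∫ s in (0 : ℝ)..t, ‖g s - k s‖ ^ 2 := by
  intro t ht
  obtain ⟨Z, hZ, hZn⟩ := H.exists_linearSolution hK hb (0 : X) (hg.sub hk)
  have h1 := hW.sub hV (integrableOn_clm_comp b hg) (integrableOn_clm_comp b hk)
  have h2 := h1.sub hZ ((integrableOn_clm_comp b hg).sub (integrableOn_clm_comp b hk))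
    (integrableOn_clm_comp b (hg.sub hk))
  simp only [Pi.sub_apply, map_sub, sub_self] at h2
  have h3 := H.eq_zero h2 t ht
  have h4 := hZn t ht
  rw [map_zero, sub_zero, ← sub_eq_zero.1 h3] at h4
  exact h4

end Cauchy

/-! ### The semilinear equation -/

theorem memLp_Ioc_of_continuousOn {E : Type*} [NormedAddCommGroup E] {a c : ℝ} {f : ℝ → E}
    (hf : ContinuousOn f (Icc a c)) : MemLp f 2 (volume.restrict (Ioc a c)) := by
  obtain ⟨C, hC⟩ := isCompact_Icc.exists_bound_of_continuousOn hf
  refine MemLp.of_bound (integrableOn_Ioc_of_continuousOn hf).1 C ?_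
  filter_upwards [ae_restrict_mem measurableSet_Ioc] with s hs using hC s (Ioc_subset_Icc_self hs)

/-- Iterating the inequality `φₙ₊₁(t) ≤ C ∫₀ᵗ φₙ` produces the terms of the exponential series. -/
theorem iterate_integral_le {φ : ℕ → ℝ → ℝ} {C M N : ℝ} (hC : 0 ≤ C)
    (hφ : ∀ n, ContinuousOn (φ n) (Icc 0 N)) (h0 : ∀ t ∈ Icc 0 N, φ 0 t ≤ M)
    (hs : ∀ n, ∀ t ∈ Icc 0 N, φ (n + 1) t ≤ C * ∫ s in (0 : ℝ)..t, φ n s) (n : ℕ) :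
    ∀ t ∈ Icc 0 N, φ n t ≤ M * ((C * t) ^ n / n.factorial) := by
  induction n with
  | zero => simpa using h0
  | succ n ih =>
    intro t ht
    have hi : IntervalIntegrable (φ n) volume 0 t :=
      intervalIntegrable_of_mem_Icc (integrableOn_Ioc_of_continuousOn (hφ n)) ht
    have hc : Continuous fun s : ℝ => M * ((C * s) ^ n / n.factorial) := by fun_prop
    have h1 : ∫ s in (0 : ℝ)..t, φ n s ≤ ∫ s in (0 : ℝ)..t, M * ((C * s) ^ n / n.factorial) :=
      intervalIntegral.integral_mono_on ht.1 hi (hc.intervalIntegrable _ _) fun s hs =>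
        ih s ⟨hs.1, hs.2.trans ht.2⟩
    refine (hs n t ht).trans ((mul_le_mul_of_nonneg_left h1 hC).trans_eq ?_)
    have e : ∀ s : ℝ, M * ((C * s) ^ n / n.factorial) = M * C ^ n / n.factorial * s ^ n :=
        fun s => by
      rw [mul_pow]
      ring
    simp only [e]
    rw [intervalIntegral.integral_const_mul, integral_pow, Nat.factorial_succ]
    push_cast
    field_simp
    ring

section Semilinear

variable {𝕜 : Type*} [RCLike 𝕜]
variable {X : Type*} [NormedAddCommGroup X] [InnerProductSpace 𝕜 X] [NormedSpace ℝ X]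

theorem IsLinearSolution.congr {R : X →L[𝕜] X} {N : ℝ} {W₀ : X} {h k W V : ℝ → X}
    (hW : IsLinearSolution R N W₀ h W) (hk : EqOn h k (Icc 0 N)) (hV : EqOn W V (Icc 0 N)) :
    IsLinearSolution R N W₀ k V where
  continuousOn := hW.continuousOn.congr hV.symm
  equation t ht := by
    rw [← hV ht, hW.equation t ht]
    refine intervalIntegral.integral_congr fun s hs => ?_
    rw [uIcc_of_le ht.1] at hs
    have hs' : s ∈ Icc 0 N := ⟨hs.1, hs.2.trans ht.2⟩
    simp only [hk hs', hV hs']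

theorem IsLinearSolution.mono {R : X →L[𝕜] X} {N N' : ℝ} {W₀ : X} {h W : ℝ → X}
    (hW : IsLinearSolution R N W₀ h W) (hN : N' ≤ N) : IsLinearSolution R N' W₀ h W where
  continuousOn := hW.continuousOn.mono (Icc_subset_Icc_right hN)
  equation t ht := hW.equation t ⟨ht.1, ht.2.trans hN⟩

variable [CompleteSpace X] {U : Type*} [NormedAddCommGroup U] [NormedSpace 𝕜 U]

/-- The difference of two solutions with inputs `F(V) + h` is controlled by the difference of the
functions `V` that are fed back. -/
theorem IsInverseGenerator.norm_sub_sq_le_of_lipschitz {R : X →L[𝕜] X} {T : UnitaryGroup 𝕜 X}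
    (H : IsInverseGenerator R T) {b : U →L[𝕜] X} {K : ℝ} (hK : 0 ≤ K)
    (hb : IsAdmissibleInput R T b K) {F : X → U} {L : ℝ≥0} (hF : LipschitzWith L F) {N : ℝ}
    {h : ℝ → U} (hh : MemLp h 2 (volume.restrict (Ioc 0 N))) {W₀ : X} {W V W' V' : ℝ → X}
    (hW : ContinuousOn W (Icc 0 N)) (hV : ContinuousOn V (Icc 0 N))
    (hW' : IsLinearSolution R N W₀ (fun s => b (F (W s) + h s)) W')
    (hV' : IsLinearSolution R N W₀ (fun s => b (F (V s) + h s)) V') :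
    ∀ t ∈ Icc 0 N, ‖W' t - V' t‖ ^ 2 ≤
      K * (N + 2) * L ^ 2 * ∫ s in (0 : ℝ)..t, ‖W s - V s‖ ^ 2 := by
  intro t ht
  have hFW : ContinuousOn (fun s => F (W s)) (Icc 0 N) := hF.continuous.comp_continuousOn hW
  have hFV : ContinuousOn (fun s => F (V s)) (Icc 0 N) := hF.continuous.comp_continuousOn hV
  have h1 := H.norm_sub_sq_le hK hb ((memLp_Ioc_of_continuousOn hFW).add hh)
    ((memLp_Ioc_of_continuousOn hFV).add hh) hW' hV' t ht
  refine h1.trans ?_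
  rw [mul_assoc (K * (N + 2)), ← intervalIntegral.integral_const_mul ((L : ℝ) ^ 2)]
  have hKN : 0 ≤ K * (N + 2) := mul_nonneg hK (by linarith [ht.1, ht.2])
  refine mul_le_mul_of_nonneg_left ?_ hKN
  have i1 : ContinuousOn (fun s => ‖F (W s) - F (V s)‖ ^ 2) (Icc 0 N) := (hFW.sub hFV).norm.pow 2
  have i2 : ContinuousOn (fun s => (L : ℝ) ^ 2 * ‖W s - V s‖ ^ 2) (Icc 0 N) :=
    continuousOn_const.mul ((hW.sub hV).norm.pow 2)
  have e : ∀ s, (F (W s) + h s) - (F (V s) + h s) = F (W s) - F (V s) := fun s => by abel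
  simp only [Pi.add_apply, e]
  refine intervalIntegral.integral_mono_on ht.1
    (intervalIntegrable_of_mem_Icc (integrableOn_Ioc_of_continuousOn i1) ht)
    (intervalIntegrable_of_mem_Icc (integrableOn_Ioc_of_continuousOn i2) ht) fun s _ => ?_
  rw [← mul_pow]
  refine pow_le_pow_left₀ (norm_nonneg _) ?_ 2
  simpa [dist_eq_norm] using hF.dist_le_mul (W s) (V s)

/-- Uniqueness for the semilinear equation. -/
theorem IsInverseGenerator.eqOn_of_lipschitz {R : X →L[𝕜] X} {T : UnitaryGroup 𝕜 X}
    (H : IsInverseGenerator R T) {b : U →L[𝕜] X} {K : ℝ} (hK : 0 ≤ K)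
    (hb : IsAdmissibleInput R T b K) {F : X → U} {L : ℝ≥0} (hF : LipschitzWith L F) {N : ℝ}
    {h : ℝ → U} (hh : MemLp h 2 (volume.restrict (Ioc 0 N))) {W₀ : X} {W V : ℝ → X}
    (hW : IsLinearSolution R N W₀ (fun s => b (F (W s) + h s)) W)
    (hV : IsLinearSolution R N W₀ (fun s => b (F (V s) + h s)) V) : EqOn W V (Icc 0 N) := by
  intro t ht
  have hN : 0 ≤ N := ht.1.trans ht.2
  have hc : ContinuousOn (fun s => ‖W s - V s‖ ^ 2) (Icc 0 N) :=
    (hW.continuousOn.sub hV.continuousOn).norm.pow 2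
  obtain ⟨M, hM⟩ := isCompact_Icc.exists_bound_of_continuousOn hc
  have h1 := fun n => iterate_integral_le (φ := fun _ s => ‖W s - V s‖ ^ 2) (M := M)
    (C := K * (N + 2) * L ^ 2) (by positivity) (fun _ => hc)
    (fun s hs => (le_abs_self _).trans (hM s hs))
    (fun _ => H.norm_sub_sq_le_of_lipschitz hK hb hF hh hW.continuousOn hV.continuousOn hW hV)
    n t ht
  have h2 := (FloorSemiring.tendsto_pow_div_factorial_atTop (K * (N + 2) * L ^ 2 * t)).const_mul M
  have h3 := ge_of_tendsto' h2 h1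
  rw [mul_zero] at h3
  have h4 : ‖W t - V t‖ = 0 := pow_eq_zero_iff (two_ne_zero) |>.1 (le_antisymm h3 (sq_nonneg _))
  exact sub_eq_zero.1 (norm_eq_zero.1 h4)

/-- Existence for the semilinear equation on a bounded time interval: some iterate of the map that
feeds a function back into the linear equation is a contraction. -/
theorem IsInverseGenerator.exists_of_lipschitz {R : X →L[𝕜] X} {T : UnitaryGroup 𝕜 X}
    (H : IsInverseGenerator R T) {b : U →L[𝕜] X} {K : ℝ} (hK : 0 ≤ K)
    (hb : IsAdmissibleInput R T b K) {F : X → U} {L : ℝ≥0} (hF : LipschitzWith L F) {N : ℝ}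
    (hN : 0 ≤ N) {h : ℝ → U} (hh : MemLp h 2 (volume.restrict (Ioc 0 N))) (W₀ : X) :
    ∃ W, IsLinearSolution R N W₀ (fun s => b (F (W s) + h s)) W := by
  let ext : C(Icc 0 N, X) → ℝ → X := fun W => IccExtend hN W
  have hext : ∀ W, Continuous (ext W) := fun W => W.continuous.Icc_extend'
  have hex : ∀ W, ∃ V : C(Icc 0 N, X),
      IsLinearSolution R N W₀ (fun s => b (F (ext W s) + h s)) (ext V) := fun W => by
    have h1 : MemLp (fun s => F (ext W s) + h s) 2 (volume.restrict (Ioc 0 N)) :=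
      (memLp_Ioc_of_continuousOn (hF.continuous.comp (hext W)).continuousOn).add hh
    obtain ⟨V, hV, -⟩ := H.exists_linearSolution hK hb W₀ h1
    refine ⟨⟨fun s => V s, continuousOn_iff_continuous_domRestrict.1 hV.continuousOn⟩,
      hV.congr (fun _ _ => rfl) fun s hs => ?_⟩
    simp only [ext]
    rw [IccExtend_of_mem hN _ hs]
    rfl
  choose Γ hΓ using hex
  have hdist : ∀ W V : C(Icc 0 N, X), ∀ s, ‖ext W s - ext V s‖ ≤ dist W V := fun W V s => by
    rw [← dist_eq_norm]
    exact ContinuousMap.dist_apply_le_dist _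
  set C := K * (N + 2) * (L : ℝ) ^ 2 with hCdef
  have hC : 0 ≤ C := by positivity
  have hiter : ∀ n, ∀ W V : C(Icc 0 N, X), ∀ t ∈ Icc 0 N,
      ‖ext (Γ^[n] W) t - ext (Γ^[n] V) t‖ ^ 2 ≤ dist W V ^ 2 * ((C * t) ^ n / n.factorial) := by
    intro n W V
    refine iterate_integral_le (φ := fun n t => ‖ext (Γ^[n] W) t - ext (Γ^[n] V) t‖ ^ 2) hC
      (fun n => (((hext _).sub (hext _)).norm.pow 2).continuousOn)
      (fun t _ => pow_le_pow_left₀ (norm_nonneg _) (hdist W V t) 2) (fun n => ?_) n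
    simp only [Function.iterate_succ_apply']
    exact H.norm_sub_sq_le_of_lipschitz hK hb hF hh (hext _).continuousOn (hext _).continuousOn
      (hΓ _) (hΓ _)
  obtain ⟨n, hn⟩ := ((FloorSemiring.tendsto_pow_div_factorial_atTop (C * N)).eventually
    (gt_mem_nhds (show (0 : ℝ) < 1 / 4 by norm_num))).exists
  have hcontr : ContractingWith (1 / 2) Γ^[n] := by
    refine ⟨by rw [div_lt_one] <;> norm_num, LipschitzWith.of_dist_le_mul fun W V => ?_⟩
    have hr : ((1 / 2 : ℝ≥0) : ℝ) = 1 / 2 := by norm_num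
    rw [hr, ContinuousMap.dist_le (by positivity)]
    intro t
    have h1 := hiter n W V t t.2
    have h2 : (C * t) ^ n / n.factorial ≤ 1 / 4 := by
      refine le_trans ?_ hn.le
      have : C * (t : ℝ) ≤ C * N := mul_le_mul_of_nonneg_left t.2.2 hC
      have h3 : 0 ≤ C * (t : ℝ) := mul_nonneg hC t.2.1
      gcongr
    have h3 : ‖ext (Γ^[n] W) t - ext (Γ^[n] V) t‖ ^ 2 ≤ (1 / 2 * dist W V) ^ 2 := by
      nlinarith [sq_nonneg (dist W V)]
    have h4 := (sq_le_sq₀ (norm_nonneg _) (by positivity)).1 h3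
    simpa only [ext, IccExtend_val, ← dist_eq_norm] using h4
  have hfix : Function.IsFixedPt Γ (ContractingWith.fixedPoint Γ^[n] hcontr) :=
    hcontr.isFixedPt_fixedPoint_iterate
  refine ⟨ext (ContractingWith.fixedPoint Γ^[n] hcontr), ?_⟩
  have h1 := hΓ (ContractingWith.fixedPoint Γ^[n] hcontr)
  rwa [hfix.eq] at h1

/-- The semilinear equation has a global solution. -/
theorem IsInverseGenerator.exists_global {R : X →L[𝕜] X} {T : UnitaryGroup 𝕜 X}
    (H : IsInverseGenerator R T) {b : U →L[𝕜] X} {K : ℝ} (hK : 0 ≤ K)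
    (hb : IsAdmissibleInput R T b K) {F : X → U} {L : ℝ≥0} (hF : LipschitzWith L F)
    {h : ℝ → U} (hh : ∀ N : ℝ, MemLp h 2 (volume.restrict (Ioc 0 N))) (W₀ : X) :
    ∃ W, ∀ N : ℝ, IsLinearSolution R N W₀ (fun s => b (F (W s) + h s)) W := by
  choose V hV using fun n : ℕ => H.exists_of_lipschitz hK hb hF n.cast_nonneg (hh n) W₀
  -- `V n` is a solution on `[0, n]`; at time `t` any `n ≥ t` may be used
  let W : ℝ → X := fun t => V ⌈t⌉₊ t
  have hWV : ∀ n : ℕ, EqOn (V n) W (Icc 0 n) := fun n t ht => by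
    have h1 : ((min n ⌈t⌉₊ : ℕ) : ℝ) ≤ n := Nat.cast_le.2 (min_le_left _ _)
    have h2 : ((min n ⌈t⌉₊ : ℕ) : ℝ) ≤ (⌈t⌉₊ : ℕ) := Nat.cast_le.2 (min_le_right _ _)
    refine H.eqOn_of_lipschitz hK hb hF (hh _) ((hV n).mono h1) ((hV ⌈t⌉₊).mono h2) ⟨ht.1, ?_⟩
    rw [Nat.cast_min]
    exact le_min ht.2 (Nat.le_ceil t)
  refine ⟨W, fun N => ?_⟩
  refine ((hV ⌈N⌉₊).congr (fun s hs => ?_) (hWV _)).mono (Nat.le_ceil N)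
  simp only [hWV _ hs]

end Semilinear

/-! ### Generators and admissible control operators -/

section Transport

variable {𝕜 : Type*} [RCLike 𝕜]
variable {X : Type*} [NormedAddCommGroup X] [InnerProductSpace 𝕜 X] [CompleteSpace X]

/-- In the extrapolation space, `x = A (R x)` for every `x ∈ X`. -/
theorem embed_eq_extendOp {A : X →ₗ.[𝕜] X} {R : X →L[𝕜] X}
    (hskew : ∀ x y, ⟪R x, y⟫_𝕜 = -⟪x, R y⟫_𝕜) (hA : ∀ p, p ∈ A†.graph ↔ p.1 = -R p.2) (x : X) :
    embed A x = extendOp A (R x) := by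
  ext z
  rw [embed_apply, extendOp_apply, (hA z.1).1 z.2, inner_neg_left, hskew, neg_neg]

theorem extendOp_injective {A : X →ₗ.[𝕜] X} {R : X →L[𝕜] X}
    (hA : ∀ p, p ∈ A†.graph ↔ p.1 = -R p.2) : Function.Injective (extendOp A) := by
  intro x y h
  refine ext_inner_left 𝕜 fun v => ?_
  exact congrArg (fun ξ : Extrapolation A => ξ ⟨(-R v, v), (hA _).2 rfl⟩) h

theorem IsGenerator.extrapolate_extendOp {A : X →ₗ.[𝕜] X} {T : UnitaryGroup 𝕜 X}
    (hT : IsGenerator A T) (t : ℝ) (x : X) :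
    hT.extrapolate t (extendOp A x) = extendOp A (T t x) := by
  ext z
  change ⟪(T t).symm z.1.2, x⟫_𝕜 = ⟪z.1.2, T t x⟫_𝕜
  rw [← LinearIsometryEquiv.inner_map_map (T t), LinearIsometryEquiv.apply_symm_apply]

variable [NormedSpace ℝ X]

theorem IsInverseGenerator.hasDerivAt {R : X →L[𝕜] X} {T : UnitaryGroup 𝕜 X}
    (H : IsInverseGenerator R T) (x : X) (t : ℝ) :
    HasDerivAt (fun s => T s (R x)) (T t x) t := by
  have h1 : HasDerivAt (fun s => ∫ r in (0 : ℝ)..s, T r x) (T t x) t :=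
    intervalIntegral.integral_hasDerivAt_right ((T.continuous' x).intervalIntegrable _ _)
      ((T.continuous' x).stronglyMeasurableAtFilter _ _) (T.continuous' x).continuousAt
  refine (h1.const_add (R x)).congr_of_eventuallyEq (Eventually.of_forall fun s => ?_)
  simp only [← H.integral, add_sub_cancel]

theorem IsInverseGenerator.isGenerator [IsScalarTower ℝ 𝕜 X] {A : X →ₗ.[𝕜] X} {R : X →L[𝕜] X}
    {T : UnitaryGroup 𝕜 X} (H : IsInverseGenerator R T)
    (hA : ∀ x y, (x, y) ∈ A.graph ↔ x = R y) : IsGenerator A T := by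
  have key : ∀ y, Tendsto (fun t : ℝ => (t : 𝕜)⁻¹ • (T t (R y) - R y)) (𝓝[≠] 0) (𝓝 y) := by
    intro y
    have h := hasDerivAt_iff_tendsto_slope.1 (H.hasDerivAt y 0)
    rw [T.map_zero'] at h
    refine h.congr fun t => ?_
    rw [slope_def_module, sub_zero, T.map_zero', RCLike.real_smul_eq_coe_smul (K := 𝕜),
      RCLike.ofReal_inv]
  intro x y
  rw [hA]
  constructor
  · rintro rfl
    exact key y
  · intro h
    have h1 := (R.continuous.tendsto y).comp h
    refine tendsto_nhds_unique (key x) (h1.congr fun t => ?_)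
    simp only [Function.comp_apply, map_smul, map_sub, H.comm]

theorem norm_sq_Lp_two {α E : Type*} [MeasurableSpace α] {μ : Measure α} [NormedAddCommGroup E]
    (v : Lp E 2 μ) : ‖v‖ ^ 2 = ∫ a, ‖v a‖ ^ 2 ∂μ := by
  have h : 0 ≤ ∫ a, ‖v a‖ ^ 2 ∂μ := integral_nonneg fun _ => by positivity
  rw [Lp.norm_def, (Lp.memLp v).eLpNorm_eq_integral_rpow_norm two_ne_zero ENNReal.ofNat_ne_top]
  simp only [ENNReal.toReal_ofNat, Real.rpow_two]
  rw [ENNReal.toReal_ofReal (by positivity), ← one_div, ← Real.sqrt_eq_rpow, Real.sq_sqrt h]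

/-- If the control operator `B` is `R⁻¹ b` with an admissible input operator `b`, then it is
admissible. -/
theorem IsAdmissibleInput.isAdmissible {U : Type*} [NormedAddCommGroup U] [NormedSpace 𝕜 U]
    {A : X →ₗ.[𝕜] X} {R : X →L[𝕜] X} {T : UnitaryGroup 𝕜 X} (hT : IsGenerator A T)
    (H : IsInverseGenerator R T) (hA : ∀ p, p ∈ A†.graph ↔ p.1 = -R p.2) {b : U →L[𝕜] X} {K : ℝ}
    (hK : 0 ≤ K) (hb : IsAdmissibleInput R T b K) {B : U →L[𝕜] Extrapolation A}
    (hB : ∀ c, B c = extendOp A (b c)) : IsAdmissible hT B := by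
  intro τ hτ
  have hint : ∀ v : Lp U 2 (volume.restrict (Ioc (0 : ℝ) τ)),
      IntegrableOn (fun σ => T (τ - σ) (b (v σ))) (Ioc 0 τ) := fun v =>
    T.integrable_comp (measurable_const.sub measurable_id).aemeasurable
      (integrableOn_clm_comp b (Lp.memLp v))
  have hex : ∀ v : Lp U 2 (volume.restrict (Ioc (0 : ℝ) τ)), ∃ z : X,
      R z = ∫ σ in Ioc 0 τ, T (τ - σ) (b (v σ)) ∧ ‖z‖ ≤ √(K * (τ + 2)) * ‖v‖ := by
    intro v
    obtain ⟨z, hz, hzn⟩ := hb 0 τ hτ.le v (Lp.memLp v)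
    refine ⟨T τ z, ?_, ?_⟩
    · rw [← H.comm, hz, intervalIntegral.integral_of_le hτ.le]
      refine ((T τ).toLinearIsometry.integral_comp_comm (fun r => T (-r) (b (v r)))).symm.trans ?_
      refine integral_congr_ae (Eventually.of_forall fun r => ?_)
      change T τ (T (-r) (b (v r))) = _
      rw [← T.map_add', ← sub_eq_add_neg]
    · rw [LinearIsometryEquiv.norm_map]
      rw [intervalIntegral.integral_of_le hτ.le, ← norm_sq_Lp_two, sub_zero] at hzn
      rw [← Real.sqrt_sq (norm_nonneg v), ← Real.sqrt_mul (by positivity)]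
      exact Real.le_sqrt_of_sq_le hzn
  choose Φ hΦ hΦn using hex
  refine ⟨LinearMap.mkContinuous
    { toFun := Φ
      map_add' := fun v w => ?_
      map_smul' := fun c v => ?_ } (√(K * (τ + 2))) hΦn, fun v => ?_⟩
  · apply H.injective
    rw [map_add, hΦ, hΦ, hΦ, ← integral_add (hint v) (hint w)]
    refine integral_congr_ae ?_
    filter_upwards [Lp.coeFn_add v w] with σ hσ
    rw [hσ, Pi.add_apply, map_add, map_add]
  · apply H.injective
    rw [map_smul, RingHom.id_apply, hΦ, hΦ, ← integral_smul]
    refine integral_congr_ae ?_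
    filter_upwards [Lp.coeFn_smul c v] with σ hσ
    rw [hσ, Pi.smul_apply, map_smul, map_smul]
  · have e : ∀ σ, hT.extrapolate (τ - σ) (B (v σ)) = extendOp A (T (τ - σ) (b (v σ))) := fun σ => by
      rw [hB, hT.extrapolate_extendOp]
    simp only [e]
    refine ⟨(extendOp A).integrable_comp (hint v), ?_⟩
    rw [ContinuousLinearMap.integral_comp_comm _ (hint v), ← hΦ, ← embed_eq_extendOp H.skew hA]
    rfl

omit [CompleteSpace X] in
/-- Two admissible inputs can be used simultaneously. -/
theorem IsAdmissibleInput.coprod {R : X →L[𝕜] X} {T : UnitaryGroup 𝕜 X} {b₁ b₂ : 𝕜 →L[𝕜] X}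
    {K₁ K₂ : ℝ} (hK₁ : 0 ≤ K₁) (hK₂ : 0 ≤ K₂) (h₁ : IsAdmissibleInput R T b₁ K₁)
    (h₂ : IsAdmissibleInput R T b₂ K₂) :
    IsAdmissibleInput R T (b₁.coprod b₂) (2 * (K₁ + K₂)) := by
  intro a c hac g hg
  have hg₁ : MemLp (fun r => (g r).1) 2 (volume.restrict (Ioc a c)) :=
    hg.mono (continuous_fst.comp_aestronglyMeasurable hg.1)
      (Eventually.of_forall fun r => norm_fst_le _)
  have hg₂ : MemLp (fun r => (g r).2) 2 (volume.restrict (Ioc a c)) :=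
    hg.mono (continuous_snd.comp_aestronglyMeasurable hg.1)
      (Eventually.of_forall fun r => norm_snd_le _)
  obtain ⟨z₁, hz₁, hn₁⟩ := h₁ a c hac _ hg₁
  obtain ⟨z₂, hz₂, hn₂⟩ := h₂ a c hac _ hg₂
  have i : ∀ b : 𝕜 →L[𝕜] X, ∀ k : ℝ → 𝕜, MemLp k 2 (volume.restrict (Ioc a c)) →
      IntervalIntegrable (fun r => T (-r) (b (k r))) volume a c := fun b k hk =>
    (intervalIntegrable_iff_integrableOn_Ioc_of_le hac).2
      (T.integrable_comp measurable_neg.aemeasurable (integrableOn_clm_comp b hk))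
  refine ⟨z₁ + z₂, ?_, ?_⟩
  · rw [map_add, hz₁, hz₂, ← intervalIntegral.integral_add (i b₁ _ hg₁) (i b₂ _ hg₂)]
    exact intervalIntegral.integral_congr fun r _ => by
      simp only [ContinuousLinearMap.coprod_apply, map_add]
  · have sq : ∀ k : ℝ → 𝕜, MemLp k 2 (volume.restrict (Ioc a c)) → (∀ r, ‖k r‖ ≤ ‖g r‖) →
        ∫ r in a..c, ‖k r‖ ^ 2 ≤ ∫ r in a..c, ‖g r‖ ^ 2 := fun k hk hkg =>
      intervalIntegral.integral_mono_on hac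
        ((intervalIntegrable_iff_integrableOn_Ioc_of_le hac).2 hk.norm.integrable_sq)
        ((intervalIntegrable_iff_integrableOn_Ioc_of_le hac).2 hg.norm.integrable_sq)
        fun r _ => pow_le_pow_left₀ (norm_nonneg _) (hkg r) 2
    have s₁ := mul_le_mul_of_nonneg_left (sq _ hg₁ fun r => norm_fst_le _)
      (mul_nonneg hK₁ (by linarith : 0 ≤ c - a + 2))
    have s₂ := mul_le_mul_of_nonneg_left (sq _ hg₂ fun r => norm_snd_le _)
      (mul_nonneg hK₂ (by linarith : 0 ≤ c - a + 2))
    have h3 : ‖z₁ + z₂‖ ^ 2 ≤ 2 * ‖z₁‖ ^ 2 + 2 * ‖z₂‖ ^ 2 := by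
      have := pow_le_pow_left₀ (norm_nonneg _) (norm_add_le z₁ z₂) 2
      nlinarith [sq_nonneg (‖z₁‖ - ‖z₂‖)]
    linarith

end Transport

/-! ### The inverse of the wave operator -/

section Inverse

variable (𝕜 : Type*) [RCLike 𝕜]

theorem exists_waveInv : ∃ R : StateSpace 𝕜 →L[𝕜] StateSpace 𝕜,
    ∀ z y, (z, y) ∈ waveGraph 𝕜 ↔ z = R y := by
  choose g hg using waveGraph_surj (𝕜 := 𝕜)
  have huniq : ∀ z y, (z, y) ∈ waveGraph 𝕜 → z = g y := fun z y hz => by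
    have h1 : (z - g y, (0 : StateSpace 𝕜)) ∈ waveGraph 𝕜 := by
      simpa using (waveGraph 𝕜).sub_mem hz (hg y)
    have h2 := waveGraph_skew (hg (z - g y)) h1
    simp only [inner_zero_right, neg_zero, inner_self_eq_zero] at h2
    exact sub_eq_zero.1 h2
  let G : StateSpace 𝕜 →ₗ[𝕜] StateSpace 𝕜 :=
    { toFun := g
      map_add' := fun x y => (huniq _ _ ((waveGraph 𝕜).add_mem (hg x) (hg y))).symm
      map_smul' := fun c x => (huniq _ _ ((waveGraph 𝕜).smul_mem c (hg x))).symm }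
  have hskew : ∀ x y, ⟪g x, y⟫_𝕜 = -⟪x, g y⟫_𝕜 := fun x y => by
    have h1 : ⟪x, g y⟫_𝕜 = -⟪g x, y⟫_𝕜 := waveGraph_skew (hg x) (hg y)
    rw [h1, neg_neg]
  -- an everywhere defined skew-symmetric operator is bounded (Hellinger-Toeplitz)
  have hG : Continuous G := by
    refine LinearMap.continuous_of_seq_closed_graph _ fun u x y hu hgu => ?_
    refine ext_inner_right 𝕜 fun v => ?_
    have h1 : Tendsto (fun n => ⟪g (u n), v⟫_𝕜) atTop (𝓝 ⟪y, v⟫_𝕜) := hgu.inner tendsto_const_nhds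
    have h2 : Tendsto (fun n => -⟪u n, g v⟫_𝕜) atTop (𝓝 (-⟪x, g v⟫_𝕜)) :=
      (hu.inner tendsto_const_nhds).neg
    simp only [hskew] at h1
    exact (tendsto_nhds_unique h1 h2).trans (hskew x v).symm
  exact ⟨⟨G, hG⟩, fun z y => ⟨huniq z y, fun h => by rw [h]; exact hg y⟩⟩

/-- The bounded inverse `𝔸⁻¹` of the wave operator, characterized by `mem_waveGraph_iff`. -/
noncomputable def waveInv : StateSpace 𝕜 →L[𝕜] StateSpace 𝕜 := (exists_waveInv 𝕜).choose

variable {𝕜}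

theorem mem_waveGraph_iff (z y : StateSpace 𝕜) : (z, y) ∈ waveGraph 𝕜 ↔ z = waveInv 𝕜 y :=
  (exists_waveInv 𝕜).choose_spec z y

theorem waveInv_mem (y : StateSpace 𝕜) : (waveInv 𝕜 y, y) ∈ waveGraph 𝕜 :=
  (mem_waveGraph_iff _ _).2 rfl

theorem waveInv_skew (x y : StateSpace 𝕜) : ⟪waveInv 𝕜 x, y⟫_𝕜 = -⟪x, waveInv 𝕜 y⟫_𝕜 := by
  have h1 : ⟪x, waveInv 𝕜 y⟫_𝕜 = -⟪waveInv 𝕜 x, y⟫_𝕜 :=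
    waveGraph_skew (p := (waveInv 𝕜 x, x)) (r := (waveInv 𝕜 y, y)) (waveInv_mem x) (waveInv_mem y)
  rw [h1, neg_neg]

theorem waveInv_injective : Function.Injective (waveInv 𝕜) := by
  rw [injective_iff_map_eq_zero]
  intro y hy
  exact waveGraph_snd_eq_zero (waveInv 𝕜 y, y) (waveInv_mem y) hy

theorem mem_adjoint_graph_iff_waveInv (p : StateSpace 𝕜 × StateSpace 𝕜) :
    p ∈ (waveOp 𝕜)†.graph ↔ p.1 = -waveInv 𝕜 p.2 := by
  rw [mem_adjoint_graph_iff, mem_waveGraph_iff, map_neg]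

/-- The real structure needed for integrals with values in `ℍ`. -/
noncomputable instance : NormedSpace ℝ (H1 𝕜) := NormedSpace.restrictScalars ℝ 𝕜 (H1 𝕜)

instance : IsScalarTower ℝ 𝕜 (H1 𝕜) := IsScalarTower.restrictScalars ℝ 𝕜 (H1 𝕜)

end Inverse

/-! ### Multipliers and observability of the wave equation -/

section Multiplier

variable {𝕜 : Type*} [RCLike 𝕜]

theorem norm_coe_mul_le (x : ℝ) (hx : x ∈ Ioo (0 : ℝ) 1) (c : 𝕜) : ‖(x : 𝕜) * c‖ ≤ ‖c‖ := by
  rw [norm_mul, RCLike.norm_ofReal, abs_of_pos hx.1]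
  exact mul_le_of_le_one_left (norm_nonneg _) hx.2.le

theorem norm_id_mul_le_ae (g : L2 𝕜) : ∀ᵐ x : ℝ ∂μ01, ‖(x : 𝕜) * g x‖ ≤ ‖g x‖ := by
  filter_upwards [ae_restrict_mem measurableSet_Ioo] with x hx using norm_coe_mul_le x hx _

theorem memLp_id_mul (g : L2 𝕜) : MemLp (fun x : ℝ => (x : 𝕜) * g x) 2 μ01 :=
  (Lp.memLp g).mono (RCLike.continuous_ofReal.aestronglyMeasurable.mul (Lp.aestronglyMeasurable g))
    (norm_id_mul_le_ae g)

variable (𝕜) in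
/-- Multiplication by the function `x ↦ x` on `L²(0,1)`. -/
noncomputable def mulId : L2 𝕜 →L[𝕜] L2 𝕜 :=
  LinearMap.mkContinuous
    { toFun := fun g => (memLp_id_mul g).toLp _
      map_add' := fun g h => by
        rw [← MemLp.toLp_add]
        refine MemLp.toLp_congr _ _ ?_
        filter_upwards [Lp.coeFn_add g h] with x hx
        rw [hx, Pi.add_apply, Pi.add_apply, mul_add]
      map_smul' := fun c g => by
        rw [RingHom.id_apply, ← MemLp.toLp_const_smul]
        refine MemLp.toLp_congr _ _ ?_
        filter_upwards [Lp.coeFn_smul c g] with x hx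
        rw [hx, Pi.smul_apply, Pi.smul_apply, smul_eq_mul, smul_eq_mul, mul_left_comm] } 1
    fun g => by
      rw [one_mul]
      refine Lp.norm_le_norm_of_ae_le ?_
      filter_upwards [(memLp_id_mul g).coeFn_toLp, norm_id_mul_le_ae g] with x hx hx'
      exact (congrArg norm hx).trans_le hx'

theorem mulId_ae (g : L2 𝕜) : mulId 𝕜 g =ᵐ[μ01] fun x : ℝ => (x : 𝕜) * g x :=
  (memLp_id_mul g).coeFn_toLp

theorem norm_mulId_le (g : L2 𝕜) : ‖mulId 𝕜 g‖ ≤ ‖g‖ := by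
  refine Lp.norm_le_norm_of_ae_le ?_
  filter_upwards [mulId_ae g, norm_id_mul_le_ae g] with x hx hx'
  exact (congrArg norm hx).trans_le hx'

theorem inner_mulId (g h : L2 𝕜) : ⟪mulId 𝕜 g, h⟫_𝕜 = ⟪g, mulId 𝕜 h⟫_𝕜 := by
  rw [L2.inner_def, L2.inner_def]
  refine integral_congr_ae ?_
  filter_upwards [mulId_ae g, mulId_ae h] with x hg hh
  rw [hg, hh, RCLike.inner_apply, RCLike.inner_apply, map_mul, RCLike.conj_ofReal]
  ring

/-- The product `x η(x)` belongs to `H¹(0,1)`, with derivative `x η'(x) + η(x)`. -/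
theorem exists_id_mul (η : H1 𝕜) : ∃ ξ : H1 𝕜, H1.deriv ξ = mulId 𝕜 (H1.deriv η) + H1.toL2 η ∧
    ∀ x : unitInterval, ξ x = ((x : ℝ) : 𝕜) * η x := by
  obtain ⟨ξ, h0, hξ⟩ := H1.exists_primitive (0 : 𝕜) (mulId 𝕜 (H1.deriv η) + H1.toL2 η)
  refine ⟨ξ, hξ, fun x => ?_⟩
  have hx : (0 : ℝ) ≤ x := x.2.1
  have i1 := L2.intervalIntegrable' (H1.deriv η) x
  have i1' := (intervalIntegrable_iff_integrableOn_Ioc_of_le hx).1 i1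
  have i2 : IntervalIntegrable (fun s : ℝ => (s : 𝕜) * H1.deriv η s) volume 0 x :=
    i1.continuousOn_mul RCLike.continuous_ofReal.continuousOn
  have e1 : ∫ s in (0 : ℝ)..x, (mulId 𝕜 (H1.deriv η) + H1.toL2 η : L2 𝕜) s =
      ∫ s in (0 : ℝ)..x, ((s : 𝕜) * H1.deriv η s + (η 0 + ∫ r in (0 : ℝ)..s, H1.deriv η r)) := by
    refine L2.ae_eq ?_ x
    filter_upwards [Lp.coeFn_add (mulId 𝕜 (H1.deriv η)) (H1.toL2 η), mulId_ae (H1.deriv η),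
      H1.toL2_ae η, ae_restrict_mem measurableSet_Ioo] with s h1 h2 h3 h4
    rw [h1, Pi.add_apply, h2, h3, H1.extend_of_mem η (Ioo_subset_Icc_self h4), H1.apply_eq]
  have e2 := integral_triangle_swap (f := fun _ r => H1.deriv η r) hx (i1'.comp_snd _)
  have hc : ContinuousOn (fun s : ℝ => ∫ r in (0 : ℝ)..s, H1.deriv η r) (uIcc 0 x) :=
    intervalIntegral.continuousOn_primitive_interval' i1 left_mem_uIcc
  have e3 : ∫ r in (0 : ℝ)..x, ∫ _ in r..(x : ℝ), H1.deriv η r =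
      ((x : ℝ) : 𝕜) * (∫ r in (0 : ℝ)..x, H1.deriv η r) -
        ∫ r in (0 : ℝ)..x, (r : 𝕜) * H1.deriv η r := by
    rw [← intervalIntegral.integral_const_mul, ← intervalIntegral.integral_sub (i1.const_mul _) i2]
    refine intervalIntegral.integral_congr fun r _ => ?_
    simp only [intervalIntegral.integral_const, RCLike.real_smul_eq_coe_mul, RCLike.ofReal_sub]
    ring
  have e4 : ∫ _ in (0 : ℝ)..x, η 0 = ((x : ℝ) : 𝕜) * η 0 := by
    rw [intervalIntegral.integral_const, RCLike.real_smul_eq_coe_mul, sub_zero]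
  rw [H1.apply_eq ξ, h0, hξ, e1, intervalIntegral.integral_add i2
    (intervalIntegrable_const.add hc.intervalIntegrable),
    intervalIntegral.integral_add intervalIntegrable_const hc.intervalIntegrable, e2, e3, e4,
    H1.apply_eq η x]
  ring

theorem re_inner_deriv (η : H1 𝕜) :
    2 * RCLike.re ⟪H1.deriv η, H1.toL2 η⟫_𝕜 = ‖η 1‖ ^ 2 - ‖η 0‖ ^ 2 := by
  have h := congrArg RCLike.re (H1.integral_by_parts η η)
  rw [← inner_conj_symm (H1.toL2 η), RCLike.mul_conj, RCLike.mul_conj, map_add, RCLike.conj_re] at h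
  rw [two_mul, h, ← RCLike.ofReal_pow, ← RCLike.ofReal_pow, ← RCLike.ofReal_sub, RCLike.ofReal_re]

/-- The multiplier identity: `2 Re ∫ x η' η̄ = |η(1)|² - ∫ |η|²`. -/
theorem re_inner_mulId_deriv (η : H1 𝕜) :
    2 * RCLike.re ⟪mulId 𝕜 (H1.deriv η), H1.toL2 η⟫_𝕜 = ‖η 1‖ ^ 2 - ‖H1.toL2 η‖ ^ 2 := by
  obtain ⟨ξ, hξ, hξx⟩ := exists_id_mul η
  have hL : H1.toL2 ξ = mulId 𝕜 (H1.toL2 η) := by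
    refine Lp.ext ?_
    filter_upwards [H1.toL2_ae ξ, mulId_ae (H1.toL2 η), H1.toL2_ae η,
      ae_restrict_mem measurableSet_Ioo] with x h1 h2 h3 h4
    rw [h1, h2, h3, H1.extend_of_mem ξ (Ioo_subset_Icc_self h4),
      H1.extend_of_mem η (Ioo_subset_Icc_self h4), hξx]
  have h := congrArg RCLike.re (H1.integral_by_parts ξ η)
  have h0 : ξ 0 = 0 := by simp [hξx]
  have h1 : ξ 1 = η 1 := by simp [hξx]
  rw [hξ, hL, h0, h1, inner_add_left, inner_mulId (H1.toL2 η),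
    ← inner_conj_symm (H1.toL2 η) (mulId 𝕜 _),
    map_zero (starRingEnd 𝕜), mul_zero, sub_zero, RCLike.mul_conj, map_add, map_add, RCLike.conj_re,
    ← RCLike.ofReal_pow, RCLike.ofReal_re, inner_self_eq_norm_sq] at h
  linarith

/-- The derivative as a bounded operator `H¹(0,1) → L²(0,1)`. -/
noncomputable def derivCLM : H1 𝕜 →L[𝕜] L2 𝕜 :=
  LinearMap.mkContinuous H1.deriv 1 fun φ => by
    rw [one_mul]
    refine (sq_le_sq₀ (norm_nonneg _) (norm_nonneg _)).1 ?_
    rw [H1.norm_sq_eq]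
    nlinarith [sq_nonneg ‖φ 0‖]

/-- The derivative of the first component of a state. -/
noncomputable def slopeCLM : StateSpace 𝕜 →L[𝕜] L2 𝕜 :=
  derivCLM.comp (WithLp.fstL 2 𝕜 (H1 𝕜) (L2 𝕜))

theorem norm_sq_add_norm_sq_le (z : StateSpace 𝕜) :
    ‖slopeCLM z‖ ^ 2 + ‖z.snd‖ ^ 2 ≤ ‖z‖ ^ 2 := by
  rw [WithLp.prod_norm_sq_eq_of_L2, H1.norm_sq_eq]
  change ‖H1.deriv z.fst‖ ^ 2 + _ ≤ _
  nlinarith [sq_nonneg ‖z.fst 0‖]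

variable {T : UnitaryGroup 𝕜 (StateSpace 𝕜)}

/-- The derivative along an orbit `(φ, ψ) = T(s) 𝔸⁻¹ x` of the quantity `2 Re ⟪m φ', ψ⟫` attached
to a symmetric multiplier `m`. Here `χ = φ'`, and the first component of `T(t) x` is `ψ`. -/
theorem hasDerivAt_multiplier (H : IsInverseGenerator (waveInv 𝕜) T) (m : L2 𝕜 →L[𝕜] L2 𝕜)
    (hm : ∀ g h, ⟪m g, h⟫_𝕜 = ⟪g, m h⟫_𝕜) (x : StateSpace 𝕜) (t : ℝ) {χ : H1 𝕜}
    (hχ : H1.deriv (T t (waveInv 𝕜 x)).fst = H1.toL2 χ) (hχ' : (T t x).snd = H1.deriv χ) :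
    HasDerivAt
      (fun s => 2 * RCLike.re ⟪m (slopeCLM (T s (waveInv 𝕜 x))), (T s (waveInv 𝕜 x)).snd⟫_𝕜)
      (2 * RCLike.re ⟪m (H1.deriv (T t x).fst), H1.toL2 (T t x).fst⟫_𝕜 +
        2 * RCLike.re ⟪m (H1.deriv χ), H1.toL2 χ⟫_𝕜) t := by
  have hz := H.hasDerivAt x t
  have hgr : (T t (waveInv 𝕜 x), T t x) ∈ waveGraph 𝕜 := by
    rw [mem_waveGraph_iff, H.comm]
  have h1 := ((m.comp slopeCLM).hasFDerivAt.restrictScalars ℝ).comp_hasDerivAt t hz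
  have h2 := ((WithLp.sndL 2 𝕜 (H1 𝕜) (L2 𝕜)).hasFDerivAt.restrictScalars ℝ).comp_hasDerivAt t hz
  have h3 := (h1.inner 𝕜 h2)
  have h4 := ((RCLike.reCLM (K := 𝕜)).hasFDerivAt.comp_hasDerivAt t h3).const_mul 2
  refine h4.congr_deriv ?_
  change 2 * RCLike.re (⟪m (H1.deriv (T t (waveInv 𝕜 x)).fst), (T t x).snd⟫_𝕜 +
    ⟪m (H1.deriv (T t x).fst), (T t (waveInv 𝕜 x)).snd⟫_𝕜) = _
  have h5 : (T t (waveInv 𝕜 x)).snd = H1.toL2 (T t x).fst := hgr.1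
  rw [h5, hχ, hχ', map_add, hm (H1.toL2 χ), ← inner_conj_symm (H1.toL2 χ), RCLike.conj_re]
  ring

/-- An orbit that starts in the domain of `𝔸` stays there; `χ` is the slope `φ'`. -/
theorem exists_slope (H : IsInverseGenerator (waveInv 𝕜) T) (x : StateSpace 𝕜) (t : ℝ) :
    ∃ χ : H1 𝕜, H1.deriv (T t (waveInv 𝕜 x)).fst = H1.toL2 χ ∧ (T t x).snd = H1.deriv χ ∧
      χ 1 = 0 ∧ (T t (waveInv 𝕜 x)).snd = H1.toL2 (T t x).fst := by
  have hgr : (T t (waveInv 𝕜 x), T t x) ∈ waveGraph 𝕜 := by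
    rw [mem_waveGraph_iff, H.comm]
  obtain ⟨h1, χ, h2, h3, -, h5⟩ := hgr
  exact ⟨χ, h2, h3, h5, h1⟩

theorem abs_multiplier_le {m : L2 𝕜 →L[𝕜] L2 𝕜} (hm : ∀ g, ‖m g‖ ≤ ‖g‖) (z : StateSpace 𝕜) :
    |2 * RCLike.re ⟪m (slopeCLM z), z.snd⟫_𝕜| ≤ ‖z‖ ^ 2 := by
  have h1 := (RCLike.abs_re_le_norm _).trans (norm_inner_le_norm (𝕜 := 𝕜) (m (slopeCLM z)) z.snd)
  have h2 : ‖m (slopeCLM z)‖ * ‖z.snd‖ ≤ ‖slopeCLM z‖ * ‖z.snd‖ := by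
    gcongr
    exact hm _
  rw [abs_mul, abs_two]
  nlinarith [norm_sq_add_norm_sq_le z, sq_nonneg (‖slopeCLM z‖ - ‖z.snd‖)]

/-- Integration of the derivative of a multiplier quantity. -/
theorem integral_multiplier_le {m : L2 𝕜 →L[𝕜] L2 𝕜}
    (hm : ∀ g, ‖m g‖ ≤ ‖g‖) (x : StateSpace 𝕜) {a c : ℝ} (hac : a ≤ c) {ρ' k : ℝ → ℝ}
    (hρ : ∀ t, HasDerivAt (fun s => 2 * RCLike.re ⟪m (slopeCLM (T s (waveInv 𝕜 x))),
      (T s (waveInv 𝕜 x)).snd⟫_𝕜) (ρ' t) t) (hk : Continuous k) (hkρ : ∀ t, k t ≤ ρ' t) :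
    ∫ t in a..c, k t ≤ 2 * ‖waveInv 𝕜 x‖ ^ 2 := by
  have h1 := intervalIntegral.integral_le_sub_of_hasDeriv_right_of_le hac
    (fun t _ => (hρ t).continuousAt.continuousWithinAt)
    (fun t _ => (hρ t).hasDerivWithinAt) (hk.integrableOn_Icc) (fun t _ => hkρ t)
  have h2 := abs_le.1 (abs_multiplier_le hm (T a (waveInv 𝕜 x)))
  have h3 := abs_le.1 (abs_multiplier_le hm (T c (waveInv 𝕜 x)))
  rw [LinearIsometryEquiv.norm_map] at h2 h3
  linarith [h2.1, h3.2]

theorem continuous_eval_orbit (x : StateSpace 𝕜) (y : unitInterval) :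
    Continuous fun t => (T t x).fst y :=
  ((H1.evalCLM y).comp (WithLp.fstL 2 𝕜 (H1 𝕜) (L2 𝕜))).continuous.comp (T.continuous' x)

/-- Observability estimate at `x = 1`, by the multiplier `x`. -/
theorem observability_one (H : IsInverseGenerator (waveInv 𝕜) T) {a c : ℝ} (hac : a ≤ c)
    (x : StateSpace 𝕜) :
    ∫ t in a..c, ‖(T t x).fst 1‖ ^ 2 ≤ (c - a + 2) * ‖waveInv 𝕜 x‖ ^ 2 := by
  -- the velocity along the orbit of `𝔸⁻¹ x` is the first component of `T(t) x`
  have hc : Continuous fun t => ‖(T t x).fst 1‖ ^ 2 := (continuous_eval_orbit x 1).norm.pow 2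
  choose χ hχ hχ' hχ1 hv using exists_slope H x
  have h := integral_multiplier_le norm_mulId_le x hac
    (fun t => hasDerivAt_multiplier H (mulId 𝕜) inner_mulId x t (hχ t) (hχ' t))
    (k := fun t => ‖(T t x).fst 1‖ ^ 2 - ‖waveInv 𝕜 x‖ ^ 2) (hc.sub continuous_const) (fun t => by
      have h1 := norm_sq_add_norm_sq_le (T t (waveInv 𝕜 x))
      change ‖H1.deriv (T t (waveInv 𝕜 x)).fst‖ ^ 2 + _ ≤ _ at h1
      rw [LinearIsometryEquiv.norm_map, hχ, hv] at h1
      rw [re_inner_mulId_deriv, re_inner_mulId_deriv, hχ1, norm_zero]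
      linarith)
  rw [intervalIntegral.integral_sub (hc.intervalIntegrable _ _) intervalIntegrable_const,
    intervalIntegral.integral_const, smul_eq_mul] at h
  linarith

/-- Observability estimate at `x = 0`, by comparison with `x = 1`. -/
theorem observability_zero (H : IsInverseGenerator (waveInv 𝕜) T) {a c : ℝ} (hac : a ≤ c)
    (x : StateSpace 𝕜) :
    ∫ t in a..c, ‖(T t x).fst 0‖ ^ 2 ≤ 2 * (c - a + 2) * ‖waveInv 𝕜 x‖ ^ 2 := by
  have hc0 : Continuous fun t => ‖(T t x).fst 0‖ ^ 2 := (continuous_eval_orbit x 0).norm.pow 2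
  have hc1 : Continuous fun t => ‖(T t x).fst 1‖ ^ 2 := (continuous_eval_orbit x 1).norm.pow 2
  choose χ hχ hχ' hχ1 hv using exists_slope H x
  have h := integral_multiplier_le (m := -ContinuousLinearMap.id 𝕜 (L2 𝕜))
    (fun g => by simp) x hac
    (fun t => hasDerivAt_multiplier H _ (fun g h => by simp) x t (hχ t) (hχ' t))
    (k := fun t => ‖(T t x).fst 0‖ ^ 2 - ‖(T t x).fst 1‖ ^ 2) (hc0.sub hc1) (fun t => by
      simp only [neg_apply, ContinuousLinearMap.id_apply, inner_neg_left, map_neg, mul_neg]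
      rw [re_inner_deriv, re_inner_deriv, hχ1, norm_zero]
      linarith [sq_nonneg ‖χ t 0‖])
  rw [intervalIntegral.integral_sub (hc0.intervalIntegrable _ _) (hc1.intervalIntegrable _ _)] at h
  have h1 := observability_one H hac x
  nlinarith [mul_nonneg (sub_nonneg.2 hac) (sq_nonneg ‖waveInv 𝕜 x‖)]

end Multiplier

/-! ### Abstract and weak solutions of the boundary value problem -/

theorem hasDerivWithinAt_Ici_iff {E : Type*} [NormedAddCommGroup E] [NormedSpace ℝ E]
    [CompleteSpace E] {y v : ℝ → E} (hv : ContinuousOn v (Ici 0)) :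
    (∀ t, 0 ≤ t → HasDerivWithinAt y (v t) (Ici 0) t) ↔
      ∀ t, 0 ≤ t → y t - y 0 = ∫ s in (0 : ℝ)..t, v s := by
  constructor
  · intro h t ht
    refine (intervalIntegral.integral_eq_sub_of_hasDeriv_right_of_le ht
      (fun s hs => (h s hs.1).continuousWithinAt.mono Icc_subset_Ici_self)
      (fun s hs => (h s hs.1.le).mono ?_) ?_).symm
    · exact fun r hr => hs.1.le.trans (le_of_lt hr)
    · refine ContinuousOn.intervalIntegrable (hv.mono ?_)
      rw [uIcc_of_le ht]
      exact Icc_subset_Ici_self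
  · intro h t ht
    have hV : Continuous fun s => v (max 0 s) :=
      hv.comp_continuous (continuous_const.max continuous_id) fun s => le_max_left 0 s
    have h1 : HasDerivAt (fun s => ∫ r in (0 : ℝ)..s, v (max 0 r)) (v (max 0 t)) t :=
      intervalIntegral.integral_hasDerivAt_right (hV.intervalIntegrable _ _)
        (hV.stronglyMeasurableAtFilter _ _) hV.continuousAt
    rw [max_eq_right ht] at h1
    have h2 : ∀ s ∈ Ici (0 : ℝ), y s = y 0 + ∫ r in (0 : ℝ)..s, v (max 0 r) := fun s hs => by
      rw [← sub_eq_iff_eq_add', h s hs]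
      refine intervalIntegral.integral_congr fun r hr => ?_
      rw [uIcc_of_le hs] at hr
      simp only [max_eq_right hr.1]
    exact (h1.hasDerivWithinAt.const_add (y 0)).congr h2 (h2 t ht)

section Plant

variable {𝕜 : Type*} [RCLike 𝕜]

variable (𝕜) in
/-- The state that represents the functional `(φ, ψ) ↦ φ(x)`. -/
noncomputable def evalState (x : unitInterval) : StateSpace 𝕜 :=
  WithLp.toLp 2 ((InnerProductSpace.toDual 𝕜 (H1 𝕜)).symm (H1.evalCLM x), 0)

theorem inner_evalState (x : unitInterval) (y : StateSpace 𝕜) :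
    ⟪evalState 𝕜 x, y⟫_𝕜 = y.fst x := by
  rw [WithLp.prod_inner_apply]
  change ⟪(InnerProductSpace.toDual 𝕜 (H1 𝕜)).symm (H1.evalCLM x), y.fst⟫_𝕜 +
    ⟪(0 : L2 𝕜), y.snd⟫_𝕜 = _
  rw [InnerProductSpace.toDual_symm_apply, inner_zero_left, add_zero]
  rfl

theorem inner_evalState_right (x : unitInterval) (y : StateSpace 𝕜) :
    ⟪y, evalState 𝕜 x⟫_𝕜 = conj (y.fst x) := by
  rw [← inner_conj_symm, inner_evalState]

theorem velocityAt_apply (x : unitInterval) (z : AdjointDomain (waveOp 𝕜)) :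
    velocityAt 𝕜 x z = -(z.1.2.fst x) := rfl

theorem controlOp₁_eq (c : 𝕜) : controlOp₁ 𝕜 c =
    extendOp (waveOp 𝕜) (ContinuousLinearMap.toSpanSingleton 𝕜 (evalState 𝕜 0) c) := by
  ext z
  rw [extendOp_apply, ContinuousLinearMap.toSpanSingleton_apply, inner_smul_right,
    inner_evalState_right]
  change ⟪-velocityAt 𝕜 0 z, c⟫_𝕜 = _
  rw [velocityAt_apply, neg_neg, RCLike.inner_apply]

theorem controlOp₂_eq (c : 𝕜) : controlOp₂ 𝕜 c =
    extendOp (waveOp 𝕜) (ContinuousLinearMap.toSpanSingleton 𝕜 (-evalState 𝕜 1) c) := by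
  ext z
  rw [extendOp_apply, ContinuousLinearMap.toSpanSingleton_apply, inner_smul_right, inner_neg_right,
    inner_evalState_right]
  change ⟪velocityAt 𝕜 1 z, c⟫_𝕜 = _
  rw [velocityAt_apply, RCLike.inner_apply, map_neg]

section Admissible

variable {T : UnitaryGroup 𝕜 (StateSpace 𝕜)}

theorem isAdmissibleInput_zero (H : IsInverseGenerator (waveInv 𝕜) T) :
    IsAdmissibleInput (waveInv 𝕜) T
      (ContinuousLinearMap.toSpanSingleton 𝕜 (evalState 𝕜 0)) 2 :=
  H.isAdmissibleInput zero_le_two fun a c hac x => by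
    simp only [inner_evalState]
    exact observability_zero H hac x

theorem isAdmissibleInput_one (H : IsInverseGenerator (waveInv 𝕜) T) :
    IsAdmissibleInput (waveInv 𝕜) T
      (ContinuousLinearMap.toSpanSingleton 𝕜 (-evalState 𝕜 1)) 1 :=
  H.isAdmissibleInput zero_le_one fun a c hac x => by
    simp only [inner_neg_left, norm_neg, inner_evalState, one_mul]
    exact observability_one H hac x

end Admissible

variable (𝕜) in
/-- The two boundary inputs, as an operator `𝕜 × 𝕜 → ℍ`: it is `𝔸⁻¹ (𝔹₁, 𝔹₂)`. -/
noncomputable def inputOp : 𝕜 × 𝕜 →L[𝕜] StateSpace 𝕜 :=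
  (ContinuousLinearMap.toSpanSingleton 𝕜 (evalState 𝕜 0)).coprod
    (ContinuousLinearMap.toSpanSingleton 𝕜 (-evalState 𝕜 1))

theorem inputOp_apply (c : 𝕜 × 𝕜) :
    inputOp 𝕜 c = c.1 • evalState 𝕜 0 + c.2 • -evalState 𝕜 1 := rfl

/-- The part `(-(q + 1) w(0), f(W))` of the two boundary inputs that is fed back by the state. -/
noncomputable def feedback (q : ℝ) (f : StateSpace 𝕜 → ℝ) (z : StateSpace 𝕜) : 𝕜 × 𝕜 :=
  (-(((q + 1 : ℝ) : 𝕜) * z.fst 0), (f z : 𝕜))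

theorem exists_lipschitz_feedback (q : ℝ) {f : StateSpace 𝕜 → ℝ} {K : ℝ≥0}
    (hf : LipschitzWith K f) : ∃ L : ℝ≥0, LipschitzWith L (feedback q f) := by
  have h1 : LipschitzWith (1 * K) fun z => (f z : 𝕜) :=
    (RCLike.ofRealLI (K := 𝕜)).isometry.lipschitz.comp hf
  let l : StateSpace 𝕜 →L[𝕜] 𝕜 :=
    -(((q + 1 : ℝ) : 𝕜) • (H1.evalCLM 0).comp (WithLp.fstL 2 𝕜 (H1 𝕜) (L2 𝕜)))
  exact ⟨_, l.lipschitz.prodMk h1⟩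

/-- The part `(0, u + d)` of the two boundary inputs that is given from outside. -/
def externalInput (u d : ℝ → 𝕜) (s : ℝ) : 𝕜 × 𝕜 := (0, u s + d s)

theorem memLp_externalInput {u d : ℝ → 𝕜} (hu : IsL2Loc u) (hd : IsL2Loc d) (N : ℝ) :
    MemLp (externalInput u d) 2 (volume.restrict (Ioc 0 N)) := by
  rcases le_or_gt N 0 with hN | hN
  · rw [Ioc_eq_empty hN.not_gt, Measure.restrict_empty]
    simp
  · have h := (hu N hN).add (hd N hN)
    refine h.mono ((continuous_const.prodMk continuous_id).comp_aestronglyMeasurable h.1)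
      (Eventually.of_forall fun s => ?_)
    simp [externalInput, Prod.norm_def]

theorem continuousOn_Ici_iff {E : Type*} [TopologicalSpace E] {W : ℝ → E} :
    ContinuousOn W (Ici 0) ↔ ∀ N : ℝ, ContinuousOn W (Icc 0 N) := by
  refine ⟨fun h N => h.mono Icc_subset_Ici_self, fun h t ht => ?_⟩
  have h1 := h (t + 1) t ⟨ht, by linarith⟩
  refine h1.mono_of_mem_nhdsWithin ?_
  rw [← Ici_inter_Iic]
  exact inter_mem_nhdsWithin _ (Iic_mem_nhds (by linarith))

section Solutions

variable {q : ℝ} {f : StateSpace 𝕜 → ℝ} {u d : ℝ → 𝕜} {W₀ : StateSpace 𝕜}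
  {W : ℝ → StateSpace 𝕜}

theorem intervalIntegrable_input {K : ℝ≥0} (hf : LipschitzWith K f) (hu : IsL2Loc u)
    (hd : IsL2Loc d)
    (hW : ContinuousOn W (Ici 0)) {t : ℝ} (ht : 0 ≤ t) :
    IntervalIntegrable (fun s => inputOp 𝕜 (feedback q f (W s) + externalInput u d s))
      volume 0 t := by
  obtain ⟨L, hL⟩ := exists_lipschitz_feedback q hf
  exact (intervalIntegrable_iff_integrableOn_Ioc_of_le ht).2 (integrableOn_clm_comp _
    ((memLp_Ioc_of_continuousOn (hL.continuous.comp_continuousOn (continuousOn_Ici_iff.1 hW t))).add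
      (memLp_externalInput hu hd t)))

/-- The abstract equation is the transported equation. -/
theorem isAbstractSolution_iff {K : ℝ≥0} (hf : LipschitzWith K f) (hu : IsL2Loc u)
    (hd : IsL2Loc d) :
    IsAbstractSolution q f u d W₀ W ↔ ∀ N, IsLinearSolution (waveInv 𝕜) N W₀
      (fun s => inputOp 𝕜 (feedback q f (W s) + externalInput u d s)) W := by
  have key : ContinuousOn W (Ici 0) → ∀ t, 0 ≤ t →
      ((embed (waveOp 𝕜) (W t) - embed (waveOp 𝕜) W₀ =
        ∫ s in (0 : ℝ)..t, (extendOp (waveOp 𝕜) (W s)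
          - controlOp₁ 𝕜 (((q + 1 : ℝ) : 𝕜) * (W s).fst 0)
          + controlOp₂ 𝕜 ((f (W s) : 𝕜) + u s + d s))) ↔
      waveInv 𝕜 (W t) - waveInv 𝕜 W₀ = ∫ s in (0 : ℝ)..t,
        (W s + inputOp 𝕜 (feedback q f (W s) + externalInput u d s))) := by
    intro hW t ht
    have i1 : IntervalIntegrable W volume 0 t :=
      (hW.mono (by rw [uIcc_of_le ht]; exact Icc_subset_Ici_self)).intervalIntegrable
    have e : ∀ s, extendOp (waveOp 𝕜) (W s) - controlOp₁ 𝕜 (((q + 1 : ℝ) : 𝕜) * (W s).fst 0)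
        + controlOp₂ 𝕜 ((f (W s) : 𝕜) + u s + d s) = extendOp (waveOp 𝕜)
          (W s + inputOp 𝕜 (feedback q f (W s) + externalInput u d s)) := fun s => by
      rw [controlOp₁_eq, controlOp₂_eq, ← map_sub, ← map_add, inputOp_apply]
      congr 1
      simp only [feedback, externalInput, Prod.fst_add, Prod.snd_add, add_zero,
        ContinuousLinearMap.toSpanSingleton_apply, neg_smul, add_assoc, sub_eq_add_neg]
    simp only [e]
    rw [ContinuousLinearMap.intervalIntegral_comp_comm _
        (i1.add (intervalIntegrable_input hf hu hd hW ht)),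
      embed_eq_extendOp waveInv_skew mem_adjoint_graph_iff_waveInv,
      embed_eq_extendOp waveInv_skew mem_adjoint_graph_iff_waveInv, ← map_sub]
    exact (extendOp_injective mem_adjoint_graph_iff_waveInv).eq_iff
  constructor
  · intro h N
    exact ⟨continuousOn_Ici_iff.1 h.continuousOn N,
      fun t ht => (key h.continuousOn t ht.1).1 (h.equation t ht.1)⟩
  · intro h
    have hc := continuousOn_Ici_iff.2 fun N => (h N).continuousOn
    refine ⟨hc, ?_, fun t ht => (key hc t ht).2 ((h t).equation t ⟨ht, le_rfl⟩)⟩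
    have h0 := (h 0).equation 0 ⟨le_rfl, le_rfl⟩
    rw [intervalIntegral.integral_same, sub_eq_zero] at h0
    exact waveInv_injective h0

theorem waveInv_snd (z : StateSpace 𝕜) : (waveInv 𝕜 z).snd = H1.toL2 z.fst := (waveInv_mem z).1

/-- With `φ` the first component of `𝔸⁻¹ (w, v)` one has `φ'' = v`, and integration by parts uses
up the boundary conditions of `φ` against the boundary term of the inner product of `H¹(0,1)`. -/
theorem inner_waveInv_fst (z : StateSpace 𝕜) (η : H1 𝕜) :
    ⟪η, (waveInv 𝕜 z).fst⟫_𝕜 = -⟪H1.toL2 η, z.snd⟫_𝕜 := by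
  obtain ⟨-, χ, h2, h3, h4, h5⟩ := waveInv_mem z
  have h2' : H1.deriv (waveInv 𝕜 z).fst = H1.toL2 χ := h2
  have h3' : z.snd = H1.deriv χ := h3
  have h4' : χ 0 = (waveInv 𝕜 z).fst 0 := h4
  have h := H1.integral_by_parts η χ
  rw [H1.inner_eq_add, h2', h3', ← h4', RCLike.inner_apply]
  rw [h5, zero_mul] at h
  linear_combination h

/-- The components of an equation `𝔸⁻¹ z = J`, the one in `H¹(0,1)` being tested with `η`. -/
theorem waveInv_eq_iff (z J : StateSpace 𝕜) : waveInv 𝕜 z = J ↔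
    H1.toL2 z.fst = J.snd ∧ ∀ η : H1 𝕜, ⟪H1.toL2 η, z.snd⟫_𝕜 = -⟪η, J.fst⟫_𝕜 := by
  constructor
  · rintro rfl
    exact ⟨(waveInv_snd z).symm, fun η => by rw [inner_waveInv_fst, neg_neg]⟩
  · rintro ⟨h1, h2⟩
    refine WithLp.ofLp_injective 2 (Prod.ext ?_ ?_)
    · refine ext_inner_left 𝕜 fun η => ?_
      exact (inner_waveInv_fst z η).trans (by rw [h2, neg_neg]; rfl)
    · exact (waveInv_snd z).trans h1

/-- The weak equation is the transported equation. The term `(q + 1) w(0)` becomes `q w(0)` because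
the inner product of `H¹(0,1)` contributes `w(0)`. -/
theorem isWeakSolution_iff {K : ℝ≥0} (hf : LipschitzWith K f) (hu : IsL2Loc u)
    (hd : IsL2Loc d) :
    IsWeakSolution q f u d W₀ W ↔ ∀ N, IsLinearSolution (waveInv 𝕜) N W₀
      (fun s => inputOp 𝕜 (feedback q f (W s) + externalInput u d s)) W := by
  let P : StateSpace 𝕜 →L[𝕜] L2 𝕜 := WithLp.sndL 2 𝕜 (H1 𝕜) (L2 𝕜)
  have key : ContinuousOn W (Ici 0) → ∀ t, 0 ≤ t →
      ((waveInv 𝕜 (W t) - waveInv 𝕜 W₀ = ∫ s in (0 : ℝ)..t,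
        (W s + inputOp 𝕜 (feedback q f (W s) + externalInput u d s))) ↔
      (H1.toL2 (W t).fst - H1.toL2 W₀.fst = ∫ s in (0 : ℝ)..t, (W s).snd) ∧
      ∀ η : H1 𝕜, ⟪H1.toL2 η, (W t).snd⟫_𝕜 - ⟪H1.toL2 η, W₀.snd⟫_𝕜 =
        ∫ s in (0 : ℝ)..t, (-⟪H1.deriv η, H1.deriv (W s).fst⟫_𝕜
          + (q : 𝕜) * (W s).fst 0 * conj (η 0)
          + (u s + (f (W s) : 𝕜) + d s) * conj (η 1))) := by
    intro hW t ht
    have i1 : IntervalIntegrable W volume 0 t :=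
      (hW.mono (by rw [uIcc_of_le ht]; exact Icc_subset_Ici_self)).intervalIntegrable
    have i2 := i1.add (intervalIntegrable_input (q := q) hf hu hd hW ht)
    set J := ∫ s in (0 : ℝ)..t, (W s + inputOp 𝕜 (feedback q f (W s) + externalInput u d s))
    have hP : ∀ c, P (inputOp 𝕜 c) = 0 := fun c => by
      have h0 : ∀ x, P (evalState 𝕜 x) = 0 := fun _ => rfl
      rw [inputOp_apply, map_add, map_smul, map_smul, map_neg, h0, h0]
      simp
    have e1 : J.snd = ∫ s in (0 : ℝ)..t, (W s).snd := by
      refine (P.intervalIntegral_comp_comm i2).symm.trans ?_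
      refine intervalIntegral.integral_congr fun s _ => ?_
      change P (W s + inputOp 𝕜 _) = _
      rw [map_add, hP, add_zero]
      rfl
    have e2 : ∀ η : H1 𝕜, -⟪η, J.fst⟫_𝕜 =
        ∫ s in (0 : ℝ)..t, (-⟪H1.deriv η, H1.deriv (W s).fst⟫_𝕜
          + (q : 𝕜) * (W s).fst 0 * conj (η 0)
          + (u s + (f (W s) : 𝕜) + d s) * conj (η 1)) := fun η => by
      let y : StateSpace 𝕜 := WithLp.toLp 2 (η, 0)
      have hy : ∀ z : StateSpace 𝕜, ⟪y, z⟫_𝕜 = ⟪η, z.fst⟫_𝕜 := fun z => by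
        rw [WithLp.prod_inner_apply]
        change ⟪η, z.fst⟫_𝕜 + ⟪(0 : L2 𝕜), z.snd⟫_𝕜 = _
        rw [inner_zero_left, add_zero]
      rw [← hy, ← inner_neg_right, ← innerSL_apply_apply 𝕜, map_neg,
        ← ContinuousLinearMap.intervalIntegral_comp_comm _ i2, ← intervalIntegral.integral_neg]
      refine intervalIntegral.integral_congr fun s _ => ?_
      simp only [innerSL_apply_apply]
      rw [inputOp_apply, inner_add_right, inner_add_right, inner_smul_right, inner_smul_right,
        inner_neg_right, inner_evalState_right, inner_evalState_right, hy, H1.inner_eq_add,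
        RCLike.inner_apply]
      simp only [feedback, externalInput, Prod.fst_add, Prod.snd_add, add_zero, RCLike.ofReal_add,
        RCLike.ofReal_one]
      change -(_ + (W s).fst 0 * conj (η 0) +
        (-(((q : 𝕜) + 1) * (W s).fst 0) * conj (η 0) + _ * -conj (η 1))) = _
      ring
    rw [← map_sub, waveInv_eq_iff, e1]
    simp only [e2, ← inner_sub_right, ← map_sub]
    rfl
  constructor
  · intro h N
    have hv : ContinuousOn (fun s => (W s).snd) (Ici 0) :=
      P.continuous.comp_continuousOn h.continuousOn
    have h1 := (hasDerivWithinAt_Ici_iff hv).1 h.velocity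
    rw [h.initial] at h1
    exact ⟨continuousOn_Ici_iff.1 h.continuousOn N, fun t ht =>
      (key h.continuousOn t ht.1).2 ⟨h1 t ht.1, fun η => h.equation η t ht.1⟩⟩
  · intro h
    have hc := continuousOn_Ici_iff.2 fun N => (h N).continuousOn
    have hv : ContinuousOn (fun s => (W s).snd) (Ici 0) := P.continuous.comp_continuousOn hc
    have h0 : W 0 = W₀ := ((isAbstractSolution_iff hf hu hd).2 h).initial
    have h1 := fun t ht => (key hc t ht).1 ((h t).equation t ⟨ht, le_rfl⟩)
    refine ⟨hc, h0, (hasDerivWithinAt_Ici_iff hv).2 fun t ht => ?_, fun η t ht => (h1 t ht).2 η⟩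
    rw [h0]
    exact (h1 t ht).1

end Solutions

end Plant

end WaveSystem

theorem proposition1p1 {𝕜 : Type*} [RCLike 𝕜] :
    (∃ (T : WaveSystem.UnitaryGroup 𝕜 (WaveSystem.StateSpace 𝕜))
        (hT : WaveSystem.IsGenerator (WaveSystem.waveOp 𝕜) T),
        WaveSystem.IsAdmissible hT (WaveSystem.controlOp₁ 𝕜) ∧
        WaveSystem.IsAdmissible hT (WaveSystem.controlOp₂ 𝕜)) ∧
    ∀ (q : ℝ), 0 < q →
      ∀ (f : WaveSystem.StateSpace 𝕜 → ℝ), (∃ K : ℝ≥0, LipschitzWith K f) → f 0 = 0 →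
      ∀ (w₀ : WaveSystem.H1 𝕜) (w₁ : WaveSystem.L2 𝕜) (u d : ℝ → 𝕜),
        WaveSystem.IsL2Loc u → WaveSystem.IsL2Loc d →
        ∃ W : ℝ → WaveSystem.StateSpace 𝕜,
          WaveSystem.IsWeakSolution q f u d (WithLp.toLp 2 (w₀, w₁)) W ∧
          WaveSystem.IsAbstractSolution q f u d (WithLp.toLp 2 (w₀, w₁)) W ∧
          ∀ V : ℝ → WaveSystem.StateSpace 𝕜,
            (WaveSystem.IsWeakSolution q f u d (WithLp.toLp 2 (w₀, w₁)) V ∨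
              WaveSystem.IsAbstractSolution q f u d (WithLp.toLp 2 (w₀, w₁)) V) →
            EqOn V W (Ici 0) := by
  obtain ⟨T, hTR, hT⟩ := WaveSystem.exists_unitaryGroup WaveSystem.waveInv_skew
    (WaveSystem.waveInv_injective (𝕜 := 𝕜))
  have H : WaveSystem.IsInverseGenerator (WaveSystem.waveInv 𝕜) T :=
    ⟨WaveSystem.waveInv_skew, WaveSystem.waveInv_injective, hTR, hT⟩
  have hb₁ := WaveSystem.isAdmissibleInput_zero H
  have hb₂ := WaveSystem.isAdmissibleInput_one H
  refine ⟨⟨T, H.isGenerator fun x y => by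
      rw [WaveSystem.waveOp_graph, WaveSystem.mem_waveGraph_iff], ?_, ?_⟩, ?_⟩
  · exact hb₁.isAdmissible _ H WaveSystem.mem_adjoint_graph_iff_waveInv zero_le_two
      WaveSystem.controlOp₁_eq
  · exact hb₂.isAdmissible _ H WaveSystem.mem_adjoint_graph_iff_waveInv zero_le_one
      WaveSystem.controlOp₂_eq
  · rintro q - f ⟨K, hf⟩ - w₀ w₁ u d hu hd
    obtain ⟨L, hL⟩ := WaveSystem.exists_lipschitz_feedback q hf
    have hb : WaveSystem.IsAdmissibleInput (WaveSystem.waveInv 𝕜) T (WaveSystem.inputOp 𝕜)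
        (2 * (2 + 1)) := hb₁.coprod zero_le_two zero_le_one hb₂
    have hK : (0 : ℝ) ≤ 2 * (2 + 1) := by norm_num
    have hh := WaveSystem.memLp_externalInput hu hd
    obtain ⟨W, hW⟩ := H.exists_global hK hb hL hh (WithLp.toLp 2 (w₀, w₁))
    refine ⟨W, (WaveSystem.isWeakSolution_iff hf hu hd).2 hW,
      (WaveSystem.isAbstractSolution_iff hf hu hd).2 hW, fun V hV t ht => ?_⟩
    have hV' := hV.elim (WaveSystem.isWeakSolution_iff hf hu hd).1
      (WaveSystem.isAbstractSolution_iff hf hu hd).1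
    exact H.eqOn_of_lipschitz hK hb hL (hh t) (hV' t) (hW t) ⟨ht, le_rfl⟩
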